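/- Let $n\ge 35$ be an integer, $i_0,j_0\in\{0,\dots,n\}$, $0<\varepsilon<1$ and $K>0$. Write $e(x)=\exp(2i\pi x)$, $\omega_0(x)=\exp(-(1-x^2)^{-1})$ for $|x|<1$ and $\omega_0(x)=0$ for $|x|\ge 1$, $c_0=\int_{\mathbf R}\omega_0$, $\omega(x)=4c_0^{-1}\omega_0(4x-3)$, $$h(x,y)=\sum_{j\ge 1}\frac1{xj}\Big(\omega(xj)-\omega\Big(\frac{|y|}{xj}\Big)\Big)\quad(x>0,\ y\in\mathbf R),\qquad \underline\omega_\varepsilon(x)=c_0^{-1}\int_{-\infty}^{x/\varepsilon-1}\omega_0(t)\,dt .$$ For $Q>1$ let $c_Q$ be the constant in the Duke--Friedlander--Iwaniec formula $\delta_l=c_QQ^{-2}\sum_{q\ge1}\sum_{d\in(\mathbf Z/q\mathbf Z)^*}e(dl/q)\,h(q/Q,l/Q^2)$ $(l\in\mathbf Z$; $\delta_0=1$ and $\delta_l=0$ for $l\ne0)$, that is, $c_Q=Q^2\big(\sum_{q\ge1}\varphi(q)h(q/Q,0)\big)^{-1}$ (well defined for all large $Q$). For $B\ge1$ put $Q=\sqrt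 B$. For $\boldsymbol x,\boldsymbol y,\boldsymbol c\in\mathbf Z^{n+1}$ and $q\ge 1$ put $P=B/(x_{i_0}y_{j_0})$ and $$w(x_{i_0},y_{j_0})=\underline\omega_\varepsilon(x_{i_0}-1)\,\underline\omega_\varepsilon(B^{1/3}-x_{i_0})\,\underline\omega_\varepsilon(y_{j_0}-1)\,\underline\omega_\varepsilon(B^{2/3}-x_{i_0}y_{j_0}),$$ $$w(\boldsymbol x,\boldsymbol y)=\prod_{i\ne i_0}\underline\omega_\varepsilon\Big(1-\frac{|x_i|}{x_{i_0}}\Big)\underline\omega_\varepsilon\Big(\frac{|x_i|}{x_{i_0}}-\frac1{x_{i_0}}\Big)\prod_{j\ne j_0}\underline\omega_\varepsilon\Big(1-\frac{|y_j|}{y_{j_0}}\Big)\underline\omega_\varepsilon\Big(\frac{|y_j|}{y_{j_0}}-\frac1{y_{j_0}}\Big),$$ $$w(\boldsymbol z)=\prod_{k=0}^n\underline\omega_\varepsilon\Big(1-\frac{|z_k|}P\Big)\underline\omega_\varepsilon\Big(\frac{|z_k|}P-\frac1P\Big)\quad(\boldsymbol z\in\mathbf R^{n+1}),$$ $$S_q(\boldsymbol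 x,\boldsymbol y)(\boldsymbol c)=\sum_{d\in(\mathbf Z/q\mathbf Z)^*}\ \sum_{\boldsymbol b\in(\mathbf Z/q\mathbf Z)^{n+1}}e\Big(\frac{d\sum_kx_ky_kb_k+\sum_kc_kb_k}{q}\Big),$$ $$I_q(\boldsymbol x,\boldsymbol y)(\boldsymbol c)=c_Q\int_{\mathbf R^{n+1}}\frac{w(\boldsymbol z)}{Q^2}\,h\Big(\frac qQ,\frac{\sum_kx_ky_kz_k}{Q^2}\Big)e\Big(-\frac{\sum_kc_kz_k}{q}\Big)d\boldsymbol z .$$ (Only terms with $w(x_{i_0},y_{j_0})\neq0$, hence $x_{i_0},y_{j_0}>1$, contribute to the sum below.) Then for every $B\ge 1$ the sum $$E(B)=\sum_{x_{i_0},y_{j_0}}w(x_{i_0},y_{j_0})\sum_{\substack{(x_i)_{i\ne i_0}\\(y_j)_{j\ne j_0}}}w(\boldsymbol x,\boldsymbol y)\sum_{\substack{\boldsymbol c\in\mathbf Z^{n+1}\\ \boldsymbol c\ne\boldsymbol 0}}\ \sum_{1\le q\le KQ}q^{-n-1}S_q(\boldsymbol x,\boldsymbol y)(\boldsymbol c)\,I_q(\boldsymbol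 x,\boldsymbol y)(\boldsymbol c)$$ converges absolutely as a sum over $(\boldsymbol x,\boldsymbol y,\boldsymbol c)$, and $E(B)=O(B^n)$ as $B\to\infty$, where the implied constant depends only on $n$, $i_0$, $j_0$, $\varepsilon$ and $K$. -/

import Mathlib

open Filter MeasureTheory Asymptotics

noncomputable section

namespace TriProjective

/-- The additive character `e(x) = exp(2 i π x)`. -/
def e (x : ℝ) : ℂ := Complex.exp (2 * Real.pi * Complex.I * x)

/-- The bump function `ω₀`. -/
def omega0 (x : ℝ) : ℝ := if |x| < 1 then Real.exp (-(1 - x ^ 2)⁻¹) else 0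

/-- `c₀ = ∫ ω₀`. -/
def c0 : ℝ := ∫ x, omega0 x

/-- `ω(x) = 4 c₀⁻¹ ω₀(4x - 3)`, supported on `[1/2, 1]`. -/
def omega (x : ℝ) : ℝ := 4 * c0⁻¹ * omega0 (4 * x - 3)

/-- The function `h(x, y) = ∑_{j > 0} (1 / (x j)) (ω(x j) - ω(|y| / (x j)))`, used for `x > 0`
(the sum then has finitely many nonzero terms). The index `j` stands for `j + 1`. -/
def h (x y : ℝ) : ℝ :=
  ∑' j : ℕ, 1 / (x * (j + 1)) * (omega (x * (j + 1)) - omega (|y| / (x * (j + 1))))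

/-- The constant `c_Q` of the identity
`δ_l = c_Q Q⁻² ∑_{q ≥ 1} ∑_{d mod q, (d, q) = 1} e(d l / q) h(q / Q, l / Q²)`, `l ∈ ℤ`:
the case `l = 0` reads `1 = c_Q Q⁻² ∑_{q ≥ 1} φ(q) h(q / Q, 0)` and determines it.
The term `q = 0` contributes `φ(0) = 0`. -/
def cQ (Q : ℝ) : ℝ := (Q⁻¹ ^ 2 * ∑' q : ℕ, (Nat.totient q : ℝ) * h (q / Q) 0)⁻¹

/-- The smooth step `c₀⁻¹ ∫_{-∞}^{x/ε - 1} ω₀`: it is `0` for `x ≤ 0` and `1` for `x ≥ 2ε`. -/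
def step (ε x : ℝ) : ℝ := c0⁻¹ * ∫ y in Set.Iic (x / ε - 1), omega0 y

/-- The weight in the two distinguished coordinates `X = x_{i₀}`, `Y = y_{j₀}`. -/
def wMax (ε B X Y : ℝ) : ℝ :=
  step ε (X - 1) * step ε (B ^ (1 / 3 : ℝ) - X) * step ε (Y - 1) *
    step ε (B ^ (2 / 3 : ℝ) - X * Y)

/-- The weight in the remaining coordinates of a vector `x` whose distinguished index is `i₀`. -/
def wRest {n : ℕ} (ε : ℝ) (i₀ : Fin (n + 1)) (x : Fin (n + 1) → ℤ) : ℝ :=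
  ∏ i ∈ Finset.univ.erase i₀,
    (step ε (1 - |(x i : ℝ)| / (x i₀ : ℝ)) *
      step ε (|(x i : ℝ)| / (x i₀ : ℝ) - 1 / (x i₀ : ℝ)))

/-- The weight in `z`, where `P` will be `B / (x_{i₀} y_{j₀})`. -/
def wZ {n : ℕ} (ε P : ℝ) (z : Fin (n + 1) → ℝ) : ℝ :=
  ∏ k, (step ε (1 - |z k| / P) * step ε (|z k| / P - 1 / P))

/-- The exponential sum `S_q(x, y)(c)`: the residue classes modulo `q ≥ 1` are represented by
`0, …, q - 1`. -/
def S {n : ℕ} (q : ℕ) (x y c : Fin (n + 1) → ℤ) : ℂ :=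
  ∑ d ∈ (Finset.range q).filter (fun d => Nat.Coprime d q), ∑ b : Fin (n + 1) → Fin q,
    e (((d : ℝ) * ∑ k, (x k : ℝ) * (y k : ℝ) * ((b k : ℕ) : ℝ)
        + ∑ k, (c k : ℝ) * ((b k : ℕ) : ℝ)) / (q : ℝ))

/-- The integral `I_q(x, y)(c)`, with `Q = √B` and `P = B / (x_{i₀} y_{j₀})`. -/
def I {n : ℕ} (ε B : ℝ) (i₀ j₀ : Fin (n + 1)) (q : ℕ) (x y c : Fin (n + 1) → ℤ) : ℂ :=
  (cQ (√B) : ℂ) * ∫ z : Fin (n + 1) → ℝ,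
    ((wZ ε (B / ((x i₀ : ℝ) * (y j₀ : ℝ))) z / √B ^ 2 *
        h ((q : ℝ) / √B) ((∑ k, (x k : ℝ) * (y k : ℝ) * z k) / √B ^ 2) : ℝ) : ℂ) *
      e (-(∑ k, (c k : ℝ) * z k) / (q : ℝ))

/-- The contribution of one triple `(x, y, c)`: its weight times
`∑_{1 ≤ q ≤ K √B} q^{-n-1} S_q(x, y)(c) I_q(x, y)(c)`. -/
def term {n : ℕ} (ε K B : ℝ) (i₀ j₀ : Fin (n + 1)) (x y c : Fin (n + 1) → ℤ) : ℂ :=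
  ((wMax ε B (x i₀) (y j₀) * (wRest ε i₀ x * wRest ε j₀ y) : ℝ) : ℂ) *
    ∑ q ∈ Finset.Icc 1 ⌊K * √B⌋₊, ((q : ℂ) ^ (n + 1))⁻¹ * S q x y c * I ε B i₀ j₀ q x y c

end TriProjective

end

open scoped ContDiff


/-! Write X = x_{i₀}, Y = y_{j₀}, L = XY, m_k = x_k y_k, P = B/L. On the support of the weights
|x_k| ≤ X, |y_k| ≤ Y, no coordinate vanishes, and L ≤ B^{2/3}. Two absolute bounds are multiplied.
Summing over b mod q shows that q^{-n-1}|S_q| is at most the number of units d with d m_k + c_k ≡ 0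
mod q for every k (`norm_S_le`). Trivially |I_q| ≪ |c_Q| P^{n+1}/(√B q), and c_Q is bounded for
large Q (`exists_abs_cQ_le`). There are at most B^{4/3} pairs (X, Y) and K√B moduli, so B^n follows
once the unit counts, summed over the relevant (x, y, c), are O(q L^{n+1} B^{-7/3}): a saving of
B^{7/3} over the trivial q L^{n+1}.

Repeated integration by parts (`exists_bound_integral_amplitude`) decides which c are relevant.
Along a coordinate axis it forces |c_k| ≤ B^{1/1000} L/√B, so |c_k| ≤ B^{1/6 + 1/1000}. Along m_l
e_k - m_k e_l the argument of h is constant, so only the smooth weight is differentiated; this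
forces the minors c_k m_l - c_l m_k to be at most B^{1/1000} q L²/B. All other triples have a
contribution of relative size B^{-3} times a summable function of c (`exists_norm_I_le`).

The relevant triples are counted in two ways (`exists_sum_majorSet_le`), each saving about B^{1/12}
per coordinate; a divisor bound passes from m_k to (x_k, y_k). If q > B^{1/4}, then for given d and
c_k the congruence fixes m_k mod q, leaving about (L/q) B^{1/6} ≤ L B^{-1/12} choices per k
(`sum_unitCount_le`). If q ≤ B^{1/4}, the coordinate with the largest |c_k| is chosen freely at cost
L B^{1/6}, and the minors leave about q L²/B ≤ L B^{-1/12} choices for each of the n others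
(`card_near_le`). For n ≥ 35 both savings exceed B^{7/3}, with room for the factors B^{1/1000}. -/

namespace TriProjective

/-! ### Calculus of functions with controlled derivatives -/

/-- `f` is smooth and its derivatives up to order `N` satisfy `|f⁽ⁱ⁾| ≤ A αⁱ`. -/
def DerivBound (f : ℝ → ℝ) (A α : ℝ) (N : ℕ) : Prop :=
  ContDiff ℝ ∞ f ∧ ∀ i ≤ N, ∀ x, |iteratedDeriv i f x| ≤ A * α ^ i

namespace DerivBound

variable {f g : ℝ → ℝ} {A A' α β : ℝ} {N : ℕ}

lemma abs_le (h : DerivBound f A α N) (x : ℝ) : |f x| ≤ A := by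
  simpa using h.2 0 (Nat.zero_le _) x

lemma nonneg (h : DerivBound f A α N) : 0 ≤ A := (abs_nonneg _).trans (h.abs_le 0)

lemma contDiffAt (h : DerivBound f A α N) (i : ℕ) (x : ℝ) : ContDiffAt ℝ i f x :=
  (h.1.of_le (by exact_mod_cast le_top)).contDiffAt

lemma mono (h : DerivBound f A α N) (hA : A ≤ A') (hα : 0 ≤ α) (hαβ : α ≤ β) :
    DerivBound f A' β N := by
  refine ⟨h.1, fun i hi x => (h.2 i hi x).trans ?_⟩
  have := h.nonneg.trans hA
  gcongr

lemma rescale {κ : ℝ} (h : DerivBound f A (κ * α) N) (hκ : 1 ≤ κ) (hα : 0 ≤ α) :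
    DerivBound f (A * κ ^ N) α N := by
  refine ⟨h.1, fun i hi x => (h.2 i hi x).trans ?_⟩
  have := h.nonneg
  rw [mul_pow, ← mul_assoc]
  gcongr

lemma add (hf : DerivBound f A α N) (hg : DerivBound g A' α N) :
    DerivBound (fun x => f x + g x) (A + A') α N := by
  refine ⟨hf.1.add hg.1, fun i hi x => ?_⟩
  rw [iteratedDeriv_fun_add (hf.contDiffAt i x) (hg.contDiffAt i x), add_mul]
  exact (abs_add_le _ _).trans (add_le_add (hf.2 i hi x) (hg.2 i hi x))

lemma mul (hf : DerivBound f A α N) (hg : DerivBound g A' β N) :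
    DerivBound (fun x => f x * g x) (A * A') (α + β) N := by
  refine ⟨hf.1.mul hg.1, fun i hi x => ?_⟩
  rw [iteratedDeriv_fun_mul (hf.contDiffAt i x) (hg.contDiffAt i x), add_pow, Finset.mul_sum]
  refine (Finset.abs_sum_le_sum_abs _ _).trans (Finset.sum_le_sum fun j hj => ?_)
  have hj' : j ≤ i := Nat.lt_succ_iff.1 (Finset.mem_range.1 hj)
  have h1 := hf.2 j (hj'.trans hi) x
  have h2 := hg.2 (i - j) ((Nat.sub_le _ _).trans hi) x
  rw [abs_mul, abs_mul, Nat.abs_cast]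
  calc (i.choose j : ℝ) * |iteratedDeriv j f x| * |iteratedDeriv (i - j) g x|
      ≤ (i.choose j : ℝ) * (A * α ^ j) * (A' * β ^ (i - j)) := by
        have := (abs_nonneg _).trans h1
        gcongr
    _ = _ := by ring

lemma const_mul (hf : DerivBound f A α N) (c : ℝ) :
    DerivBound (fun x => c * f x) (|c| * A) α N := by
  refine ⟨contDiff_const.mul hf.1, fun i hi x => ?_⟩
  rw [iteratedDeriv_const_mul_field, abs_mul, mul_assoc]
  exact mul_le_mul_of_nonneg_left (hf.2 i hi x) (abs_nonneg _)

lemma comp_affine (hf : DerivBound f A α N) (a c : ℝ) :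
    DerivBound (fun t => f (a + c * t)) A (α * |c|) N := by
  have h1 : ContDiff ℝ ∞ (fun t => f (a + t)) := hf.1.comp (contDiff_const.add contDiff_id)
  refine ⟨h1.comp (contDiff_const.mul contDiff_id), fun i hi x => ?_⟩
  rw [iteratedDeriv_comp_const_mul (f := fun t => f (a + t)) (h1.of_le (by exact_mod_cast le_top)) c,
    iteratedDeriv_comp_const_add, abs_mul, abs_pow, mul_pow]
  have := hf.2 i hi (a + c * x)
  calc |c| ^ i * |iteratedDeriv i f (a + c * x)| ≤ |c| ^ i * (A * α ^ i) := by gcongr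
    _ = _ := by ring

end DerivBound

lemma hasCompactSupport_iteratedDeriv {f : ℝ → ℝ} (hs : HasCompactSupport f) (i : ℕ) :
    HasCompactSupport (iteratedDeriv i f) := by
  induction i with
  | zero => simpa using hs
  | succ i ih => rw [iteratedDeriv_succ]; exact ih.deriv

lemma exists_derivBound_of_hasCompactSupport {f : ℝ → ℝ} (hf : ContDiff ℝ ∞ f)
    (hs : HasCompactSupport f) (N : ℕ) : ∃ A, DerivBound f A 1 N := by
  have h : ∀ i, ∃ C, ∀ x, |iteratedDeriv i f x| ≤ C := fun i =>
    (hasCompactSupport_iteratedDeriv hs i).exists_bound_of_continuous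
      (hf.continuous_iteratedDeriv i (by exact_mod_cast le_top))
  choose C hC using h
  refine ⟨∑ i ∈ Finset.range (N + 1), C i, hf, fun i hi x => ?_⟩
  rw [one_pow, mul_one]
  exact (hC i x).trans (Finset.single_le_sum (f := C)
    (fun j _ => (abs_nonneg _).trans (hC j 0)) (Finset.mem_range.2 (Nat.lt_succ_of_le hi)))

/-! ### The bump function, the smooth step and the weight in z -/

lemma omega0_eq (x : ℝ) : omega0 x = expNegInvGlue (1 - x ^ 2) := by
  unfold omega0 expNegInvGlue
  have : |x| < 1 ↔ ¬ (1 - x ^ 2 ≤ 0) := by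
    rw [← sq_lt_one_iff_abs_lt_one, not_le, sub_pos]
  by_cases h : |x| < 1
  · rw [if_pos h, if_neg (this.1 h)]
  · rw [if_neg h, if_pos (by rwa [this, not_not] at h)]

lemma contDiff_omega0 : ContDiff ℝ ∞ omega0 := by
  rw [funext omega0_eq]
  exact expNegInvGlue.contDiff.comp (contDiff_const.sub (contDiff_id.pow 2))

lemma omega0_nonneg (x : ℝ) : 0 ≤ omega0 x := by
  rw [omega0_eq]; exact expNegInvGlue.nonneg _

lemma omega0_eq_zero {x : ℝ} (h : 1 ≤ |x|) : omega0 x = 0 := if_neg (not_lt.2 h)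

lemma hasCompactSupport_omega0 : HasCompactSupport omega0 := by
  refine HasCompactSupport.intro (isCompact_Icc (a := (-1 : ℝ)) (b := 1)) fun x hx => ?_
  refine omega0_eq_zero ?_
  by_contra! h
  exact hx ⟨(abs_lt.1 h).1.le, (abs_lt.1 h).2.le⟩

lemma integrable_omega0 : Integrable omega0 :=
  contDiff_omega0.continuous.integrable_of_hasCompactSupport hasCompactSupport_omega0

lemma c0_pos : 0 < c0 := by
  refine contDiff_omega0.continuous.integral_pos_of_hasCompactSupport_nonneg_nonzero
    hasCompactSupport_omega0 omega0_nonneg (x := 0) ?_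
  simp [omega0, Real.exp_ne_zero]

lemma step_nonneg (ε x : ℝ) : 0 ≤ step ε x :=
  mul_nonneg (inv_nonneg.2 c0_pos.le) (setIntegral_nonneg measurableSet_Iic fun y _ => omega0_nonneg y)

lemma step_le_one (ε x : ℝ) : step ε x ≤ 1 := by
  unfold step
  rw [inv_mul_le_one₀ c0_pos]
  exact setIntegral_le_integral integrable_omega0 (Eventually.of_forall omega0_nonneg)

lemma step_eq_zero {ε x : ℝ} (hε : 0 < ε) (hx : x ≤ 0) : step ε x = 0 := by
  unfold step
  rw [setIntegral_eq_zero_of_forall_eq_zero, mul_zero]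
  intro y hy
  refine omega0_eq_zero ?_
  have h1 : x / ε ≤ 0 := div_nonpos_of_nonpos_of_nonneg hx hε.le
  have h2 : y ≤ x / ε - 1 := hy
  rw [abs_of_nonpos (by linarith)]
  linarith

lemma pos_of_step_ne_zero {ε x : ℝ} (hε : 0 < ε) (h : step ε x ≠ 0) : 0 < x := by
  by_contra! hx
  exact h (step_eq_zero hε hx)

lemma hasDerivAt_integral_omega0 (b : ℝ) :
    HasDerivAt (fun b => ∫ y in Set.Iic b, omega0 y) (omega0 b) b := by
  have h : (fun b => ∫ y in Set.Iic b, omega0 y) =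
      fun b => (∫ y in Set.Iic 0, omega0 y) + ∫ y in (0 : ℝ)..b, omega0 y := by
    ext b
    rw [← intervalIntegral.integral_Iic_sub_Iic integrable_omega0.integrableOn
      integrable_omega0.integrableOn]
    ring
  rw [h]
  refine HasDerivAt.const_add _ ?_
  exact intervalIntegral.integral_hasDerivAt_right
    (contDiff_omega0.continuous.intervalIntegrable _ _)
    (contDiff_omega0.continuous.stronglyMeasurableAtFilter _ _)
    contDiff_omega0.continuous.continuousAt

lemma exists_derivBound_step {ε : ℝ} (hε : 0 < ε) (hε₁ : ε < 1) (N : ℕ) :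
    ∃ A, DerivBound (step ε) A 1 N := by
  obtain ⟨A, hA⟩ := exists_derivBound_of_hasCompactSupport contDiff_omega0
    hasCompactSupport_omega0 N
  set G : ℝ → ℝ := fun b => ∫ y in Set.Iic b, omega0 y with hG
  have hd : deriv G = omega0 := funext fun b => (hasDerivAt_integral_omega0 b).deriv
  have hGb : DerivBound G (c0 + A) 1 N := by
    refine ⟨contDiff_infty_iff_deriv.2
      ⟨fun b => (hasDerivAt_integral_omega0 b).differentiableAt, hd ▸ contDiff_omega0⟩,
      fun i hi x => ?_⟩
    rw [one_pow, mul_one]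
    cases i with
    | zero =>
      have h1 : 0 ≤ G x := setIntegral_nonneg measurableSet_Iic fun y _ => omega0_nonneg y
      have h2 : G x ≤ c0 :=
        setIntegral_le_integral integrable_omega0 (Eventually.of_forall omega0_nonneg)
      rw [iteratedDeriv_zero, abs_of_nonneg h1]
      linarith [hA.nonneg]
    | succ i =>
      rw [iteratedDeriv_succ', hd]
      have := hA.2 i (by omega) x
      rw [one_pow, mul_one] at this
      linarith [c0_pos]
  have h2 := ((hGb.comp_affine (-1) ε⁻¹).const_mul c0⁻¹)
  have h3 : (fun x => c0⁻¹ * G (-1 + ε⁻¹ * x)) = step ε := by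
    ext x
    simp only [hG, step]
    congr 4
    ring
  rw [h3] at h2
  -- Each derivative costs a factor ε⁻¹, which is at least 1 since ε < 1; its N-th power is absorbed
  -- into the constant.
  refine ⟨_, DerivBound.rescale (κ := |ε⁻¹|) (by simpa [mul_comm] using h2) ?_ zero_le_one⟩
  rw [abs_of_pos (inv_pos.2 hε)]
  exact (one_le_inv₀ hε).2 hε₁.le

/-- The one-dimensional factor of `wZ`. -/
noncomputable def wOne (ε P u : ℝ) : ℝ := step ε (1 - |u| / P) * step ε (|u| / P - 1 / P)

lemma wOne_nonneg (ε P u : ℝ) : 0 ≤ wOne ε P u := mul_nonneg (step_nonneg _ _) (step_nonneg _ _)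

lemma wOne_le_one (ε P u : ℝ) : wOne ε P u ≤ 1 :=
  mul_le_one₀ (step_le_one _ _) (step_nonneg _ _) (step_le_one _ _)

lemma wOne_eq_zero {ε P u : ℝ} (hε : 0 < ε) (hP : 0 < P) (hu : P ≤ |u|) : wOne ε P u = 0 := by
  rw [wOne, step_eq_zero hε, zero_mul]
  rw [sub_nonpos]
  exact (one_le_div hP).2 hu

/-- The absolute value does no harm: the second step vanishes for |u| ≤ 1, so the weight is F(u) +
F(-u) with F smooth and zero on the negative axis. The constant is uniform in P because P enters
only through affine changes of variable of slope ±1/P. -/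
lemma exists_derivBound_wOne {ε : ℝ} (hε : 0 < ε) (hε₁ : ε < 1) (N : ℕ) :
    ∃ A, ∀ P, 0 < P → DerivBound (wOne ε P) A (1 / P) N := by
  obtain ⟨A, hA⟩ := exists_derivBound_step hε hε₁ N
  refine ⟨(A * A + A * A) * 2 ^ N, fun P hP => ?_⟩
  have hP' : 0 < 1 / P := by positivity
  have h1 := hA.comp_affine 1 (-(1 / P))
  have h2 := hA.comp_affine (-(1 / P)) (1 / P)
  have h3 := h1.mul h2
  have h4 := h3.comp_affine 0 (-1)
  have h5 := h3.add (h4.mono le_rfl (by positivity) (by simp))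
  rw [abs_neg, abs_of_pos hP'] at h5
  have h6 : wOne ε P = fun x ↦
      step ε (1 + -(1 / P) * x) * step ε (-(1 / P) + 1 / P * x) +
        step ε (1 + -(1 / P) * (0 + -1 * x)) * step ε (-(1 / P) + 1 / P * (0 + -1 * x)) := by
    ext u
    have e1 : ∀ v : ℝ, 1 + -(1 / P) * v = 1 - v / P := fun v => by ring
    have e2 : ∀ v : ℝ, -(1 / P) + (1 / P) * v = v / P - 1 / P := fun v => by ring
    have key : ∀ v : ℝ, v ≤ 0 → step ε (v / P - 1 / P) = 0 := fun v hv => by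
      apply step_eq_zero hε
      have : v / P ≤ 0 := div_nonpos_of_nonpos_of_nonneg hv hP.le
      linarith
    have e3 : ∀ v : ℝ, (0 : ℝ) + -1 * v = -v := fun v => by ring
    simp only [e1, e2, e3, wOne]
    rcases le_total u 0 with hu | hu
    · rw [key u hu, abs_of_nonpos hu]; ring
    · rw [key (-u) (by linarith), abs_of_nonneg hu]; ring
  rw [h6]
  refine DerivBound.rescale ?_ one_le_two hP'.le
  convert h5 using 1
  ring

/-! ### Derivatives of h in its second variable -/

lemma omega_nonneg (x : ℝ) : 0 ≤ omega x :=
  mul_nonneg (mul_nonneg (by norm_num) (inv_nonneg.2 c0_pos.le)) (omega0_nonneg _)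

lemma omega_eq_zero {x : ℝ} (h : x ≤ 1 / 2 ∨ 1 ≤ x) : omega x = 0 := by
  rw [omega, omega0_eq_zero, mul_zero]
  rcases h with h | h
  · rw [abs_of_nonpos (by linarith)]; linarith
  · rw [abs_of_nonneg (by linarith)]; linarith

lemma contDiff_omega : ContDiff ℝ ∞ omega :=
  contDiff_const.mul (contDiff_omega0.comp ((contDiff_const.mul contDiff_id).sub contDiff_const))

lemma hasCompactSupport_omega : HasCompactSupport omega := by
  refine HasCompactSupport.intro (isCompact_Icc (a := (0 : ℝ)) (b := 1)) fun x hx => ?_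
  refine omega_eq_zero ?_
  by_contra! h
  exact hx ⟨by linarith [h.1], h.2.le⟩

lemma omega_abs (x : ℝ) : omega |x| = omega x + omega (-x) := by
  rcases le_total x 0 with h | h
  · rw [abs_of_nonpos h, omega_eq_zero (x := x) (Or.inl (by linarith)), zero_add]
  · rw [abs_of_nonneg h, omega_eq_zero (x := -x) (Or.inl (by linarith)), add_zero]

lemma contDiff_omega_abs : ContDiff ℝ ∞ (fun x => omega |x|) := by
  rw [funext omega_abs]
  exact contDiff_omega.add (contDiff_omega.comp contDiff_neg)

lemma hasCompactSupport_omega_abs : HasCompactSupport (fun x => omega |x|) := by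
  refine HasCompactSupport.intro (isCompact_Icc (a := (-1 : ℝ)) (b := 1)) fun x hx => ?_
  refine omega_eq_zero ?_
  by_contra! h
  exact hx ⟨(abs_lt.1 h.2).1.le, (abs_lt.1 h.2).2.le⟩

lemma iteratedDeriv_omega_abs_eq_zero {u : ℝ} (h : |u| < 1 / 2 ∨ 1 < |u|) (i : ℕ) :
    iteratedDeriv i (fun x => omega |x|) u = 0 := by
  have : (fun x => omega |x|) =ᶠ[nhds u] fun _ => 0 := by
    rcases h with h | h
    · filter_upwards [(isOpen_Iio.preimage continuous_abs).mem_nhds h] with v hv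
      exact omega_eq_zero (Or.inl (le_of_lt hv))
    · filter_upwards [(isOpen_Ioi.preimage continuous_abs).mem_nhds h] with v hv
      exact omega_eq_zero (Or.inr (le_of_lt hv))
  rw [this.iteratedDeriv_eq, iteratedDeriv_const]
  simp

/-- Integers in [s, 2s] number at most 2s and have inverses at most 1/s. Applied to both halves of
h, this avoids any logarithmic loss. -/
lemma sum_inv_dyadic_le (J : ℕ) {s : ℝ} (hs : 0 ≤ s) :
    ∑ j ∈ Finset.range J, (if s ≤ j + 1 ∧ (j + 1 : ℝ) ≤ 2 * s then (1 / (j + 1 : ℝ)) else 0) ≤ 2 := by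
  rcases hs.eq_or_lt with rfl | hs
  · rw [Finset.sum_eq_zero]
    · norm_num
    · intro j _
      rw [if_neg]
      rintro ⟨-, h⟩
      have : (0 : ℝ) ≤ j := j.cast_nonneg
      linarith
  rw [← Finset.sum_filter]
  have hsub : (Finset.range J).filter (fun j : ℕ => s ≤ j + 1 ∧ (j + 1 : ℝ) ≤ 2 * s) ⊆
      Finset.range ⌊2 * s⌋₊ := by
    intro j hj
    rw [Finset.mem_filter] at hj
    rw [Finset.mem_range, ← Nat.succ_le_iff]
    exact Nat.le_floor (by push_cast; exact hj.2.2)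
  calc _ ≤ ∑ j ∈ (Finset.range J).filter (fun j : ℕ => s ≤ j + 1 ∧ (j + 1 : ℝ) ≤ 2 * s), 1 / s := by
        refine Finset.sum_le_sum fun j hj => ?_
        rw [Finset.mem_filter] at hj
        exact one_div_le_one_div_of_le hs hj.2.1
    _ ≤ ⌊2 * s⌋₊ * (1 / s) := by
        rw [Finset.sum_const, nsmul_eq_mul]
        gcongr
        simpa using Finset.card_le_card hsub
    _ ≤ (2 * s) * (1 / s) := by
        gcongr
        exact Nat.floor_le (by positivity)
    _ = 2 := by field_simp

/-- The series is locally finite in y: once x(j+1) ≥ 1 and x(j+1) ≥ 2|y|, both bumps vanish.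
Smoothness and termwise differentiation follow. -/
lemma h_eventuallyEq {x : ℝ} (hx : 0 < x) (y₀ : ℝ) : ∃ J : ℕ, h x =ᶠ[nhds y₀] fun y =>
    ∑ j ∈ Finset.range J,
      1 / (x * (j + 1)) * (omega (x * (j + 1)) - omega |0 + (1 / (x * (j + 1))) * y|) := by
  obtain ⟨J, hJ⟩ := exists_nat_ge ((1 + 2 * (|y₀| + 1)) / x)
  have hJ' : 1 + 2 * (|y₀| + 1) ≤ x * J := by rwa [div_le_iff₀' hx] at hJ
  refine ⟨J, ?_⟩
  have hm : {y : ℝ | |y| < |y₀| + 1} ∈ nhds y₀ :=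
    (isOpen_Iio.preimage continuous_abs).mem_nhds (show |y₀| < |y₀| + 1 by linarith)
  filter_upwards [hm] with y hy
  have hy : |y| < |y₀| + 1 := hy
  have e : ∀ j : ℕ, omega (|y| / (x * (j + 1))) = omega |0 + (1 / (x * (j + 1))) * y| := by
    intro j
    have : 0 < x * (j + 1 : ℝ) := by positivity
    rw [zero_add, abs_mul, abs_of_pos (by positivity : 0 < 1 / (x * (j + 1 : ℝ)))]
    congr 1
    ring
  simp_rw [← e]
  refine tsum_eq_sum fun j hj => ?_
  have hj : (J : ℝ) ≤ j := by exact_mod_cast not_lt.1 (fun hh => hj (Finset.mem_range.2 hh))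
  have h0 : 0 < x * (j + 1 : ℝ) := by positivity
  have h1 : x * J ≤ x * (j + 1 : ℝ) := by gcongr; linarith
  have h2 := abs_nonneg y
  rw [omega_eq_zero (x := x * (j + 1)) (Or.inr (by linarith)),
    omega_eq_zero (x := |y| / (x * (j + 1))) (Or.inl ?_), sub_zero, mul_zero]
  rw [div_le_iff₀ h0]
  linarith

/-- The term of index j is supported where j+1 is comparable to 1/x (first bump, killed by
differentiation) or to |y|/x (second bump). Each derivative costs 1/(x(j+1)) ≤ 1/x, and the
prefactors 1/(x(j+1)) sum to at most 2/x over each dyadic range. -/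
lemma exists_derivBound_h (N : ℕ) : ∃ A, ∀ x, 0 < x → DerivBound (h x) (A / x) (1 / x) N := by
  obtain ⟨C₁, hC₁⟩ := exists_derivBound_of_hasCompactSupport contDiff_omega
    hasCompactSupport_omega N
  obtain ⟨C₂, hC₂⟩ := exists_derivBound_of_hasCompactSupport contDiff_omega_abs
    hasCompactSupport_omega_abs N
  refine ⟨2 * C₁ + 2 * C₂, fun x hx => ?_⟩
  set F : ℕ → ℝ → ℝ := fun j y =>
    1 / (x * (j + 1)) * (omega (x * (j + 1)) - omega |0 + (1 / (x * (j + 1))) * y|) with hF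
  have hsm : ∀ j : ℕ, ContDiff ℝ ∞ (fun y => omega |0 + (1 / (x * (j + 1))) * y|) :=
    fun j => (hC₂.comp_affine 0 (1 / (x * (j + 1)))).1
  have hFs : ∀ j, ContDiff ℝ ∞ (F j) := fun j => contDiff_const.mul (contDiff_const.sub (hsm j))
  refine ⟨contDiff_iff_contDiffAt.2 fun y => ?_, fun i hi y => ?_⟩
  · obtain ⟨J, hJ⟩ := h_eventuallyEq hx y
    exact ContDiffAt.congr_of_eventuallyEq
      (ContDiff.sum fun j _ => hFs j).contDiffAt hJ
  obtain ⟨J, hJ⟩ := h_eventuallyEq hx y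
  rw [hJ.iteratedDeriv_eq, iteratedDeriv_fun_sum
    (fun j _ => ((hFs j).of_le (by exact_mod_cast le_top)).contDiffAt)]
  refine (Finset.abs_sum_le_sum_abs _ _).trans ?_
  have hterm : ∀ j ∈ Finset.range J, |iteratedDeriv i (F j) y| ≤
      (C₁ / x * (1 / x) ^ i) * (if 1 / (2 * x) ≤ j + 1 ∧ (j + 1 : ℝ) ≤ 2 * (1 / (2 * x))
        then (1 / (j + 1 : ℝ)) else 0) +
      (C₂ / x * (1 / x) ^ i) * (if |y| / x ≤ j + 1 ∧ (j + 1 : ℝ) ≤ 2 * (|y| / x)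
        then (1 / (j + 1 : ℝ)) else 0) := by
    intro j _
    have ha : 0 < x * (j + 1 : ℝ) := by positivity
    have hja : 1 / (x * (j + 1 : ℝ)) ≤ 1 / x := by
      apply one_div_le_one_div_of_le hx
      have : (0 : ℝ) ≤ j := j.cast_nonneg
      nlinarith
    have e1 : iteratedDeriv i (F j) y = 1 / (x * (j + 1)) *
        (iteratedDeriv i (fun _ => omega (x * (j + 1))) y -
          iteratedDeriv i (fun y => omega |0 + (1 / (x * (j + 1))) * y|) y) := by
      rw [hF]
      simp only
      rw [iteratedDeriv_const_mul_field, iteratedDeriv_fun_sub contDiffAt_const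
        ((hsm j).of_le (by exact_mod_cast le_top)).contDiffAt]
    have e2 : iteratedDeriv i (fun y => omega |0 + (1 / (x * (j + 1))) * y|) y =
        (1 / (x * (j + 1))) ^ i * iteratedDeriv i (fun u => omega |u|) (y / (x * (j + 1))) := by
      simp only [zero_add]
      rw [iteratedDeriv_comp_const_mul (f := fun u => omega |u|)
        (contDiff_omega_abs.of_le (by exact_mod_cast le_top))]
      simp only
      congr 2
      ring
    have b1 : |1 / (x * (j + 1)) * iteratedDeriv i (fun _ : ℝ => omega (x * (j + 1))) y| ≤
        (C₁ / x * (1 / x) ^ i) * (if 1 / (2 * x) ≤ j + 1 ∧ (j + 1 : ℝ) ≤ 2 * (1 / (2 * x))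
        then (1 / (j + 1 : ℝ)) else 0) := by
      have hC := hC₁.nonneg
      rw [iteratedDeriv_const]
      by_cases hc : 1 / (2 * x) ≤ j + 1 ∧ (j + 1 : ℝ) ≤ 2 * (1 / (2 * x))
      · rw [if_pos hc]
        cases i with
        | zero =>
          simp only [if_true, pow_zero, mul_one]
          rw [abs_mul, abs_of_pos (by positivity : 0 < 1 / (x * (j + 1 : ℝ)))]
          calc _ ≤ 1 / (x * (j + 1 : ℝ)) * C₁ := by
                gcongr
                exact hC₁.abs_le _
            _ = _ := by field_simp
        | succ i => simp; positivity
      · rw [if_neg hc]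
        have : omega (x * (j + 1)) = 0 := by
          apply omega_eq_zero
          by_contra! hh
          apply hc
          constructor
          · rw [div_le_iff₀ (by positivity)]; linarith [hh.1]
          · have : 2 * (1 / (2 * x)) = 1 / x := by field_simp
            rw [this, le_div_iff₀ hx]; linarith [hh.2]
        simp [this]
    have b2 : |1 / (x * (j + 1)) *
        iteratedDeriv i (fun y => omega |0 + (1 / (x * (j + 1))) * y|) y| ≤
        (C₂ / x * (1 / x) ^ i) * (if |y| / x ≤ j + 1 ∧ (j + 1 : ℝ) ≤ 2 * (|y| / x)
        then (1 / (j + 1 : ℝ)) else 0) := by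
      have hC := hC₂.nonneg
      rw [e2]
      by_cases hc : |y| / x ≤ j + 1 ∧ (j + 1 : ℝ) ≤ 2 * (|y| / x)
      · rw [if_pos hc, abs_mul, abs_mul, abs_pow,
          abs_of_pos (by positivity : 0 < 1 / (x * (j + 1 : ℝ)))]
        have := hC₂.2 i hi (y / (x * (j + 1)))
        rw [one_pow, mul_one] at this
        calc _ ≤ 1 / (x * (j + 1 : ℝ)) * ((1 / x) ^ i * C₂) := by gcongr
          _ = _ := by field_simp
      · rw [if_neg hc, iteratedDeriv_omega_abs_eq_zero]
        · simp
        · rw [abs_div, abs_of_pos ha]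
          by_contra! hh
          apply hc
          rw [div_le_one ha, le_div_iff₀ ha] at hh
          constructor
          · rw [div_le_iff₀ hx]; linarith [hh.2]
          · rw [← mul_div_assoc, le_div_iff₀ hx]; linarith [hh.1]
    rw [e1, mul_sub]
    exact (abs_sub _ _).trans (add_le_add b1 b2)
  refine (Finset.sum_le_sum hterm).trans ?_
  rw [Finset.sum_add_distrib, ← Finset.mul_sum, ← Finset.mul_sum]
  have s1 := sum_inv_dyadic_le J (s := 1 / (2 * x)) (by positivity)
  have s2 := sum_inv_dyadic_le J (s := |y| / x) (by positivity)
  have h1 := hC₁.nonneg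
  have h2 := hC₂.nonneg
  calc _ ≤ C₁ / x * (1 / x) ^ i * 2 + C₂ / x * (1 / x) ^ i * 2 := by gcongr
    _ = _ := by ring


/-! ### Integration by parts against a linear phase -/

lemma norm_e (x : ℝ) : ‖e x‖ = 1 := by
  have : e x = Complex.exp ((2 * Real.pi * x : ℝ) * Complex.I) := by
    unfold e; congr 1; push_cast; ring
  rw [this, Complex.norm_exp_ofReal_mul_I]

section Oscillatory

variable {ι : Type*} [Fintype ι]

/-- The linear phase `z ↦ -(c · z) / r`. -/
noncomputable def phase (c : ι → ℝ) (r : ℝ) : (ι → ℝ) →L[ℝ] ℝ :=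
  (-r⁻¹) • ∑ k, c k • ContinuousLinearMap.proj (R := ℝ) (φ := fun _ : ι => ℝ) k

lemma phase_apply (c : ι → ℝ) (r : ℝ) (z : ι → ℝ) : phase c r z = -(∑ k, c k * z k) / r := by
  simp only [phase, smul_apply, sum_apply, ContinuousLinearMap.proj_apply, smul_eq_mul]
  ring

lemma hasFDerivAt_e_phase (c : ι → ℝ) (r : ℝ) (z : ι → ℝ) :
    HasFDerivAt (fun z => e (phase c r z))
      ((2 * Real.pi * Complex.I * e (phase c r z)) • (Complex.ofRealCLM ∘L phase c r)) z := by
  have h1 : HasFDerivAt (fun z => (phase c r z : ℂ)) (Complex.ofRealCLM ∘L phase c r) z :=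
    (Complex.ofRealCLM ∘L phase c r).hasFDerivAt
  have h2 := (h1.const_mul (2 * Real.pi * Complex.I)).cexp
  refine h2.congr_fderiv ?_
  ext v
  simp [e]
  ring

variable {G : (ι → ℝ) → ℝ} {v : ι → ℝ}

/-- The derivative in the direction `v`. -/
noncomputable def dirDeriv (v : ι → ℝ) (G : (ι → ℝ) → ℝ) : (ι → ℝ) → ℝ := fun z => fderiv ℝ G z v

lemma contDiff_dirDeriv (hG : ContDiff ℝ ∞ G) : ContDiff ℝ ∞ (dirDeriv v G) :=
  (hG.fderiv_right (m := ∞) (by simp)).clm_apply contDiff_const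

lemma dirDeriv_eq_zero {K : Set (ι → ℝ)} (hK : IsClosed K) (hs : ∀ z ∉ K, G z = 0) :
    ∀ z ∉ K, dirDeriv v G z = 0 := by
  intro z hz
  have : G =ᶠ[nhds z] fun _ => 0 := by
    filter_upwards [hK.isOpen_compl.mem_nhds hz] with w hw using hs w hw
  rw [dirDeriv, this.fderiv_eq]
  simp

/-- The exponential is an eigenfunction of every directional derivative, here with eigenvalue 2πi
times the phase at v; compact support leaves no boundary term. -/
lemma integral_dirDeriv_smul_e (hG : ContDiff ℝ ∞ G) {K : Set (ι → ℝ)} (hK : IsCompact K)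
    (hs : ∀ z ∉ K, G z = 0) (c : ι → ℝ) (r : ℝ) :
    ‖∫ z, dirDeriv v G z • e (phase c r z)‖ =
      2 * Real.pi * |phase c r v| * ‖∫ z, G z • e (phase c r z)‖ := by
  have hec : Continuous fun z => e (phase c r z) :=
    continuous_iff_continuousAt.2 fun z => (hasFDerivAt_e_phase c r z).continuousAt
  have hi : ∀ F : (ι → ℝ) → ℝ, Continuous F → (∀ z ∉ K, F z = 0) →
      Integrable fun z => F z • e (phase c r z) := fun F hF hF0 =>
    (hF.smul hec).integrable_of_hasCompactSupport
      (HasCompactSupport.intro hK fun z hz => by simp [hF0 z hz])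
  have hfd : ∀ z, fderiv ℝ (fun z => e (phase c r z)) z v =
      (2 * Real.pi * Complex.I * (phase c r v : ℂ)) * e (phase c r z) := by
    intro z
    rw [(hasFDerivAt_e_phase c r z).fderiv]
    simp
    ring
  have hI := hi G hG.continuous hs
  have h := integral_smul_fderiv_eq_neg_fderiv_smul_of_integrable (μ := volume)
    (f := G) (g := fun z => e (phase c r z)) (v := v)
    (hi _ (contDiff_dirDeriv hG).continuous (dirDeriv_eq_zero hK.isClosed hs))
    (by
      simp_rw [hfd, ← mul_smul_comm]
      exact hI.const_mul _)
    hI (fun z _ => (hG.differentiable (by simp)).differentiableAt)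
    (fun z _ => (hasFDerivAt_e_phase c r z).differentiableAt)
  simp_rw [hfd, ← mul_smul_comm] at h
  rw [integral_const_mul] at h
  have h2 := congrArg norm h
  rw [norm_neg, norm_mul] at h2
  rw [show (∫ z, dirDeriv v G z • e (phase c r z)) =
    ∫ z, (fderiv ℝ G z) v • e (phase c r z) from rfl, ← h2]
  simp [abs_of_pos Real.pi_pos]

/-- Reduces iterated directional derivatives to one-variable derivatives along a line, the form in
which `DerivBound` applies. -/
lemma iterate_dirDeriv (N : ℕ) (hG : ContDiff ℝ ∞ G) (z : ι → ℝ) (t : ℝ) :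
    iteratedDeriv N (fun t : ℝ => G (z + t • v)) t = (dirDeriv v)^[N] G (z + t • v) := by
  induction N generalizing G with
  | zero => simp
  | succ N ih =>
    rw [iteratedDeriv_succ', Function.iterate_succ_apply, ← ih (contDiff_dirDeriv hG)]
    congr 1
    ext s
    have h1 : HasDerivAt (fun t : ℝ => z + t • v) v s := by
      simpa using ((hasDerivAt_id s).smul_const v).const_add z
    exact (((hG.differentiable (by simp)) (z + s • v)).hasFDerivAt.comp_hasDerivAt s h1).deriv

lemma pow_mul_norm_integral_le (N : ℕ) (hG : ContDiff ℝ ∞ G) {K : Set (ι → ℝ)} (hK : IsCompact K)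
    (hs : ∀ z ∉ K, G z = 0) (c : ι → ℝ) (r : ℝ) :
    |phase c r v| ^ N * ‖∫ z, G z • e (phase c r z)‖ ≤
      ‖∫ z, (dirDeriv v)^[N] G z • e (phase c r z)‖ := by
  induction N generalizing G with
  | zero => simp
  | succ N ih =>
    rw [Function.iterate_succ_apply]
    refine le_trans ?_ (ih (contDiff_dirDeriv hG) (dirDeriv_eq_zero hK.isClosed hs))
    rw [integral_dirDeriv_smul_e hG hK hs, pow_succ, mul_assoc]
    -- The gain of 2π at each integration by parts is not needed and is replaced by 1.
    have : 1 ≤ 2 * Real.pi := by linarith [Real.pi_gt_three]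
    have h0 : 0 ≤ |phase c r v| * ‖∫ z, G z • e (phase c r z)‖ := by positivity
    refine mul_le_mul_of_nonneg_left ?_ (by positivity)
    nlinarith

/-- Repeated integration by parts in the direction `v`. -/
lemma pow_mul_norm_integral_le_of_bound (N : ℕ) (hG : ContDiff ℝ ∞ G) {P : ℝ} (hP : 0 ≤ P)
    (hs : ∀ z, (∃ k, P < |z k|) → G z = 0) (c : ι → ℝ) {r : ℝ} (hr : 0 < r) {M : ℝ}
    (hM : ∀ z, |iteratedDeriv N (fun t : ℝ => G (z + t • v)) 0| ≤ M) :
    |∑ k, c k * v k| ^ N * ‖∫ z, (G z : ℂ) * e (-(∑ k, c k * z k) / r)‖ ≤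
      r ^ N * (M * (2 * P) ^ Fintype.card ι) := by
  set K : Set (ι → ℝ) := Set.Icc (fun _ => -P) (fun _ => P) with hKdef
  have hK : IsCompact K := isCompact_Icc
  have hs' : ∀ z ∉ K, G z = 0 := by
    intro z hz
    refine hs z ?_
    by_contra! h
    exact hz ⟨fun k => (abs_le.1 (h k)).1, fun k => (abs_le.1 (h k)).2⟩
  have h1 := pow_mul_norm_integral_le (v := v) N hG hK hs' c r
  have hz : ∀ N : ℕ, ∀ z ∉ K, (dirDeriv v)^[N] G z = 0 := by
    intro N
    induction N with
    | zero => exact hs'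
    | succ N ih =>
      rw [Function.iterate_succ_apply']
      exact dirDeriv_eq_zero hK.isClosed ih
  have hvol : volume.real K = (2 * P) ^ Fintype.card ι := by
    rw [measureReal_def, Real.volume_Icc_pi_toReal (fun _ => by linarith)]
    simp [two_mul]
  have h2 : ‖∫ z, (dirDeriv v)^[N] G z • e (phase c r z)‖ ≤ M * (2 * P) ^ Fintype.card ι := by
    rw [← setIntegral_eq_integral_of_forall_compl_eq_zero (s := K)
      (fun z hz' => by rw [hz N z hz', zero_smul]), ← hvol]
    refine norm_setIntegral_le_of_norm_le_const hK.measure_lt_top fun z _ => ?_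
    rw [norm_smul, norm_e, mul_one, Real.norm_eq_abs]
    have := hM z
    rwa [iterate_dirDeriv N hG, zero_smul, add_zero] at this
  have h3 : |∑ k, c k * v k| = r * |phase c r v| := by
    rw [phase_apply, abs_div, abs_neg, abs_of_pos hr]
    field_simp
  have h4 : (∫ z, (G z : ℂ) * e (-(∑ k, c k * z k) / r)) = ∫ z, G z • e (phase c r z) := by
    simp_rw [phase_apply, Complex.real_smul]
  rw [h3, h4, mul_pow, mul_assoc]
  exact mul_le_mul_of_nonneg_left (h1.trans h2) (by positivity)

end Oscillatory

/-! ### Two decay estimates for the oscillatory integral -/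

lemma wZ_eq {n : ℕ} (ε P : ℝ) (z : Fin (n + 1) → ℝ) : wZ ε P z = ∏ k, wOne ε P (z k) := rfl

/-- The amplitude of the integral `I`. -/
noncomputable def amplitude {n : ℕ} (ε P Q r : ℝ) (m z : Fin (n + 1) → ℝ) : ℝ :=
  wZ ε P z / Q ^ 2 * h (r / Q) ((∑ k, m k * z k) / Q ^ 2)

lemma contDiff_amplitude {n : ℕ} {ε P Q r : ℝ} (hε : 0 < ε) (hε₁ : ε < 1) (hP : 0 < P) (hQ : 0 < Q)
    (hr : 0 < r) (m : Fin (n + 1) → ℝ) : ContDiff ℝ ∞ (amplitude ε P Q r m) := by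
  obtain ⟨A, hA⟩ := exists_derivBound_wOne hε hε₁ 0
  obtain ⟨A', hA'⟩ := exists_derivBound_h 0
  unfold amplitude
  simp_rw [wZ_eq]
  refine ((contDiff_prod fun k _ => (hA P hP).1.comp (contDiff_apply ℝ ℝ k)).div_const _).mul ?_
  refine (hA' (r / Q) (by positivity)).1.comp (ContDiff.div_const ?_ _)
  exact ContDiff.sum fun k _ => contDiff_const.mul (contDiff_apply ℝ ℝ k)

lemma amplitude_eq_zero {n : ℕ} {ε P Q r : ℝ} (hε : 0 < ε) (hP : 0 < P) (m z : Fin (n + 1) → ℝ)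
    (hz : ∃ k, P < |z k|) : amplitude ε P Q r m z = 0 := by
  obtain ⟨k, hk⟩ := hz
  rw [amplitude, wZ_eq, Finset.prod_eq_zero (Finset.mem_univ k) (wOne_eq_zero hε hP hk.le)]
  simp

lemma prod_wOne_mem {ι : Type*} (s : Finset ι) (ε P : ℝ) (z : ι → ℝ) :
    0 ≤ ∏ k ∈ s, wOne ε P (z k) ∧ ∏ k ∈ s, wOne ε P (z k) ≤ 1 :=
  ⟨Finset.prod_nonneg fun _ _ => wOne_nonneg _ _ _,
    Finset.prod_le_one (fun _ _ => wOne_nonneg _ _ _) fun _ _ => wOne_le_one _ _ _⟩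

/-- Two directions are used. Along e_k both the weight and h vary, at rates 1/P and |m_k|/(rQ).
Along m_l e_k - m_k e_l the form ∑ m_j z_j is constant, so h is not differentiated and the rate is
(|m_k| + |m_l|)/P, with no loss from Q. In front stands the volume (2P)^{n+1} of the box times sup
|h|/Q² ≪ 1/(Qr). -/
lemma exists_bound_integral_amplitude {n : ℕ} {ε : ℝ} (hε : 0 < ε) (hε₁ : ε < 1) (N : ℕ) :
    ∃ A, 0 ≤ A ∧ ∀ (P Q r : ℝ) (m c : Fin (n + 1) → ℝ), 0 < P → 0 < Q → 0 < r →
      (∀ k, |c k| ^ N * ‖∫ z, (amplitude ε P Q r m z : ℂ) * e (-(∑ k, c k * z k) / r)‖ ≤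
        A * (P ^ (n + 1) / (Q * r)) * (r / P + |m k| / Q) ^ N) ∧
      (∀ k l, k ≠ l → |c k * m l - c l * m k| ^ N *
        ‖∫ z, (amplitude ε P Q r m z : ℂ) * e (-(∑ k, c k * z k) / r)‖ ≤
        A * (P ^ (n + 1) / (Q * r)) * (r * (|m k| + |m l|) / P) ^ N) := by
  obtain ⟨A, hA⟩ := exists_derivBound_wOne hε hε₁ N
  obtain ⟨A', hA'⟩ := exists_derivBound_h N
  have hA0 : 0 ≤ A := (hA 1 one_pos).nonneg
  have hA0' : 0 ≤ A' := by simpa using (hA' 1 one_pos).nonneg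
  refine ⟨2 ^ (n + 1) * (1 + A) ^ 2 * A', by positivity, fun P Q r m c hP hQ hr => ⟨fun k => ?_,
    fun k l hkl => ?_⟩⟩
  · have hb : ∀ z, |iteratedDeriv N
        (fun t : ℝ => amplitude ε P Q r m (z + t • (Pi.single k 1 : Fin (n + 1) → ℝ))) 0| ≤
        A * (A' / (r / Q)) / Q ^ 2 * (1 / P + |m k| / (r * Q)) ^ N := by
      intro z
      set C := (∏ l ∈ Finset.univ.erase k, wOne ε P (z l)) / Q ^ 2 with hC
      have hCle : |C| ≤ 1 / Q ^ 2 := by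
        have := prod_wOne_mem (Finset.univ.erase k) ε P z
        rw [abs_of_nonneg (div_nonneg this.1 (by positivity))]
        exact div_le_div_of_nonneg_right this.2 (by positivity)
      have heq : (fun t : ℝ => amplitude ε P Q r m (z + t • (Pi.single k 1 : Fin (n + 1) → ℝ))) =
          fun t => C * (wOne ε P (z k + 1 * t) *
            h (r / Q) ((∑ k, m k * z k) / Q ^ 2 + (m k / Q ^ 2) * t)) := by
        ext t
        have h1 : ∑ l, m l * (z + t • (Pi.single k 1 : Fin (n + 1) → ℝ)) l =
            ∑ l, m l * z l + m k * t := by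
          simp [mul_add, Finset.sum_add_distrib, Pi.single_apply]
        have h2 : ∏ l ∈ Finset.univ.erase k,
            wOne ε P ((z + t • (Pi.single k 1 : Fin (n + 1) → ℝ)) l) =
            ∏ l ∈ Finset.univ.erase k, wOne ε P (z l) :=
          Finset.prod_congr rfl fun l hl => by simp [Finset.ne_of_mem_erase hl]
        rw [amplitude, h1, wZ_eq, ← Finset.mul_prod_erase _ _ (Finset.mem_univ k), h2, hC, add_div]
        simp
        ring_nf
      have hd := (((hA P hP).comp_affine (z k) 1).mul ((hA' (r / Q) (by positivity)).comp_affine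
        ((∑ k, m k * z k) / Q ^ 2) (m k / Q ^ 2))).const_mul C
      rw [heq]
      refine (hd.2 N le_rfl 0).trans ?_
      have e1 : 1 / P * |(1 : ℝ)| + 1 / (r / Q) * |m k / Q ^ 2| = 1 / P + |m k| / (r * Q) := by
        rw [abs_div, abs_one, abs_of_pos (by positivity : 0 < Q ^ 2)]
        field_simp
      rw [e1]
      calc |C| * (A * (A' / (r / Q))) * (1 / P + |m k| / (r * Q)) ^ N
          ≤ 1 / Q ^ 2 * (A * (A' / (r / Q))) * (1 / P + |m k| / (r * Q)) ^ N := by gcongr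
        _ = _ := by ring
    have h := pow_mul_norm_integral_le_of_bound N (contDiff_amplitude hε hε₁ hP hQ hr m) hP.le
      (fun z hz => amplitude_eq_zero hε hP m z hz) c hr hb
    have e2 : ∑ l, c l * (Pi.single k 1 : Fin (n + 1) → ℝ) l = c k := by
      simp [Pi.single_apply]
    rw [e2, Fintype.card_fin] at h
    refine h.trans ?_
    calc _ = 2 ^ (n + 1) * A * A' * (P ^ (n + 1) / (Q * r)) *
          (r * (1 / P + |m k| / (r * Q))) ^ N := by
          rw [mul_pow r, mul_pow 2]; field_simp
      _ = 2 ^ (n + 1) * A * A' * (P ^ (n + 1) / (Q * r)) * (r / P + |m k| / Q) ^ N := by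
          congr 2; field_simp
      _ ≤ _ := by
          gcongr
          nlinarith
  · have hb : ∀ z, |iteratedDeriv N (fun t : ℝ => amplitude ε P Q r m
        (z + t • (Pi.single k (m l) - Pi.single l (m k) : Fin (n + 1) → ℝ))) 0| ≤
        A * A * (A' / (r / Q)) / Q ^ 2 * ((|m k| + |m l|) / P) ^ N := by
      intro z
      -- The value of h belongs to the constant here, since its argument does not change along this
      -- direction.
      set C := (∏ j ∈ (Finset.univ.erase k).erase l, wOne ε P (z j)) / Q ^ 2 *
        h (r / Q) ((∑ k, m k * z k) / Q ^ 2) with hC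
      have hhb := (hA' (r / Q) (by positivity)).abs_le ((∑ k, m k * z k) / Q ^ 2)
      have hCle : |C| ≤ 1 / Q ^ 2 * (A' / (r / Q)) := by
        have := prod_wOne_mem ((Finset.univ.erase k).erase l) ε P z
        rw [abs_mul, abs_of_nonneg (div_nonneg this.1 (by positivity))]
        exact mul_le_mul (div_le_div_of_nonneg_right this.2 (by positivity)) hhb (abs_nonneg _)
          (by positivity)
      have hlk : l ∈ Finset.univ.erase k := Finset.mem_erase.2 ⟨hkl.symm, Finset.mem_univ _⟩
      have heq : (fun t : ℝ => amplitude ε P Q r m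
          (z + t • (Pi.single k (m l) - Pi.single l (m k) : Fin (n + 1) → ℝ))) =
          fun t => C * (wOne ε P (z k + m l * t) * wOne ε P (z l + (-m k) * t)) := by
        ext t
        have h1 : ∑ j, m j * (z + t • (Pi.single k (m l) - Pi.single l (m k) :
            Fin (n + 1) → ℝ)) j = ∑ j, m j * z j := by
          simp [mul_add, mul_sub, Finset.sum_add_distrib, Pi.single_apply]
          ring
        have h2 : ∏ j ∈ (Finset.univ.erase k).erase l, wOne ε P
            ((z + t • (Pi.single k (m l) - Pi.single l (m k) : Fin (n + 1) → ℝ)) j) =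
            ∏ j ∈ (Finset.univ.erase k).erase l, wOne ε P (z j) :=
          Finset.prod_congr rfl fun j hj => by
            simp [Finset.ne_of_mem_erase hj, Finset.ne_of_mem_erase (Finset.mem_of_mem_erase hj)]
        rw [amplitude, h1, wZ_eq, ← Finset.mul_prod_erase _ _ (Finset.mem_univ k),
          ← Finset.mul_prod_erase _ _ hlk, h2, hC]
        simp [hkl, hkl.symm]
        ring_nf
      have hd := (((hA P hP).comp_affine (z k) (m l)).mul
        ((hA P hP).comp_affine (z l) (-m k))).const_mul C
      rw [heq]
      refine (hd.2 N le_rfl 0).trans ?_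
      have e1 : 1 / P * |m l| + 1 / P * |(-m k)| = (|m k| + |m l|) / P := by
        rw [abs_neg]; ring
      rw [e1]
      calc |C| * (A * A) * ((|m k| + |m l|) / P) ^ N
          ≤ 1 / Q ^ 2 * (A' / (r / Q)) * (A * A) * ((|m k| + |m l|) / P) ^ N := by gcongr
        _ = _ := by ring
    have h := pow_mul_norm_integral_le_of_bound N (contDiff_amplitude hε hε₁ hP hQ hr m) hP.le
      (fun z hz => amplitude_eq_zero hε hP m z hz) c hr hb
    have e2 : ∑ j, c j * (Pi.single k (m l) - Pi.single l (m k) : Fin (n + 1) → ℝ) j =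
        c k * m l - c l * m k := by
      simp [mul_sub, Pi.single_apply]
    rw [e2, Fintype.card_fin] at h
    refine h.trans ?_
    calc _ = 2 ^ (n + 1) * (A * A) * A' * (P ^ (n + 1) / (Q * r)) *
          (r * ((|m k| + |m l|) / P)) ^ N := by
          rw [mul_pow r, mul_pow 2]; field_simp
      _ = 2 ^ (n + 1) * (A * A) * A' * (P ^ (n + 1) / (Q * r)) *
          (r * (|m k| + |m l|) / P) ^ N := by rw [mul_div_assoc]
      _ ≤ _ := by
          gcongr
          nlinarith

/-! ### Divisor bound and counting of triples -/

lemma exists_succ_le_mul_two_rpow {δ : ℝ} (hδ : 0 < δ) :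
    ∃ K : ℝ, 1 ≤ K ∧ ∀ a : ℕ, (a + 1 : ℝ) ≤ K * (2 : ℝ) ^ (δ * a) := by
  have hl : 0 < δ * Real.log 2 := mul_pos hδ (Real.log_pos one_lt_two)
  refine ⟨max 1 (1 / (δ * Real.log 2)), le_max_left _ _, fun a => ?_⟩
  set K := max 1 (1 / (δ * Real.log 2)) with hK
  have h1 : 1 ≤ K := le_max_left _ _
  have h2 : 1 ≤ K * (δ * Real.log 2) := by
    rw [← div_le_iff₀ hl]; exact le_max_right _ _
  have h3 : 1 + δ * Real.log 2 * a ≤ (2 : ℝ) ^ (δ * a) := by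
    rw [Real.rpow_def_of_pos two_pos]
    have := Real.add_one_le_exp (Real.log 2 * (δ * a))
    linarith
  have ha : (0 : ℝ) ≤ a := a.cast_nonneg
  calc (a + 1 : ℝ) ≤ K * (1 + δ * Real.log 2 * a) := by nlinarith
    _ ≤ _ := by gcongr

/-- The divisor bound `τ(n) ≪ n ^ δ`. -/
theorem exists_card_divisors_le {δ : ℝ} (hδ : 0 < δ) :
    ∃ C : ℝ, 1 ≤ C ∧ ∀ n : ℕ, n ≠ 0 → (n.divisors.card : ℝ) ≤ C * (n : ℝ) ^ δ := by
  obtain ⟨K, hK1, hK⟩ := exists_succ_le_mul_two_rpow hδ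
  obtain ⟨T, hT⟩ := exists_nat_ge ((2 : ℝ) ^ (1 / δ))
  -- A prime p ≥ 2^{1/δ} has p^δ ≥ 2, so a + 1 ≤ 2^a ≤ p^{δa} without loss; each of the at most T
  -- smaller primes loses a factor K.
  refine ⟨K ^ T, one_le_pow₀ hK1, fun n hn => ?_⟩
  have hn' : (n : ℝ) ^ δ = ∏ p ∈ n.primeFactors, ((p : ℝ) ^ n.factorization p) ^ δ := by
    conv_lhs => rw [← Nat.prod_factorization_pow_eq_self hn]
    rw [Finsupp.prod, Nat.support_factorization]
    push_cast
    rw [Real.finsetProd_rpow _ _ fun p _ => by positivity]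
  have hfac : ∀ p ∈ n.primeFactors, ((n.factorization p + 1 : ℕ) : ℝ) ≤
      (if p < T then K else 1) * ((p : ℝ) ^ n.factorization p) ^ δ := by
    intro p hp
    have hp2 : (2 : ℝ) ≤ p := by exact_mod_cast (Nat.prime_of_mem_primeFactors hp).two_le
    set a := n.factorization p with ha
    have e : ((p : ℝ) ^ a) ^ δ = (p : ℝ) ^ (δ * a) := by
      rw [← Real.rpow_natCast, ← Real.rpow_mul (by positivity), mul_comm]
    rw [e]
    push_cast
    split_ifs with h
    · refine (hK a).trans ?_
      gcongr
    · have hTp : (2 : ℝ) ^ (1 / δ) ≤ p := hT.trans (by exact_mod_cast not_lt.1 h)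
      rw [one_mul, Real.rpow_mul (by positivity), Real.rpow_natCast]
      have h2 : (2 : ℝ) ≤ (p : ℝ) ^ δ := by
        calc (2 : ℝ) = ((2 : ℝ) ^ (1 / δ)) ^ δ := by
              rw [← Real.rpow_mul (by norm_num), one_div_mul_cancel hδ.ne', Real.rpow_one]
          _ ≤ _ := by gcongr
      calc (a + 1 : ℝ) ≤ (2 : ℝ) ^ a := by exact_mod_cast Nat.lt_two_pow_self
        _ ≤ _ := by gcongr
  rw [Nat.card_divisors hn, hn']
  push_cast
  calc ∏ p ∈ n.primeFactors, ((n.factorization p : ℝ) + 1)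
      ≤ ∏ p ∈ n.primeFactors, ((if p < T then K else 1) * ((p : ℝ) ^ n.factorization p) ^ δ) :=
        Finset.prod_le_prod (fun _ _ => by positivity) fun p hp => by exact_mod_cast hfac p hp
    _ = (∏ p ∈ n.primeFactors, if p < T then K else 1) *
        ∏ p ∈ n.primeFactors, ((p : ℝ) ^ n.factorization p) ^ δ := Finset.prod_mul_distrib
    _ ≤ _ := by
        gcongr
        rw [← Finset.prod_filter, Finset.prod_const]
        refine pow_le_pow_right₀ hK1 ?_
        calc _ ≤ (Finset.range T).card := Finset.card_le_card fun p hp => by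
              simpa using (Finset.mem_filter.1 hp).2
          _ = T := Finset.card_range T

/-- Replaces (a, b, c) by (ab, c): over a nonzero product m, the pair (a, b) is determined by the
sign of a and by the divisor |a| of |m|. -/
lemma card_triples_le (T : Finset (ℤ × ℤ × ℤ)) (M : Finset (ℤ × ℤ)) (D : ℕ)
    (h0 : ∀ t ∈ T, t.1 * t.2.1 ≠ 0) (hM : ∀ t ∈ T, (t.1 * t.2.1, t.2.2) ∈ M)
    (hD : ∀ t ∈ T, (t.1 * t.2.1).natAbs.divisors.card ≤ D) : T.card ≤ 2 * D * M.card := by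
  refine Finset.card_le_mul_card_image_of_maps_to (f := fun t => (t.1 * t.2.1, t.2.2)) hM _ ?_
  rintro ⟨m, c⟩ -
  rcases (T.filter fun t => (t.1 * t.2.1, t.2.2) = (m, c)).eq_empty_or_nonempty with he | ⟨t₀, ht₀⟩
  · rw [he, Finset.card_empty]
    exact Nat.zero_le _
  rw [Finset.mem_filter, Prod.mk.injEq] at ht₀
  have hm : m ≠ 0 := ht₀.2.1 ▸ h0 _ ht₀.1
  have hmD : m.natAbs.divisors.card ≤ D := ht₀.2.1 ▸ hD _ ht₀.1
  calc _ ≤ ((Finset.univ : Finset Bool) ×ˢ m.natAbs.divisors).card := by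
        refine Finset.card_le_card_of_injOn (fun t => (decide (0 < t.1), t.1.natAbs)) ?_ ?_
        · intro t ht
          rw [Finset.mem_coe, Finset.mem_filter, Prod.mk.injEq] at ht
          simp only [Finset.coe_product, Set.mem_prod, Finset.mem_coe, Finset.mem_univ, true_and,
            Nat.mem_divisors]
          refine ⟨?_, by simpa using hm⟩
          rw [Int.natAbs_dvd_natAbs]
          exact ⟨_, ht.2.1.symm⟩
        · rintro ⟨a, b, c₁⟩ ht ⟨a', b', c₂⟩ ht' heq
          rw [Finset.mem_coe, Finset.mem_filter, Prod.mk.injEq] at ht ht'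
          simp only [Prod.mk.injEq, decide_eq_decide] at heq ht ht'
          have haa : a = a' := by omega
          subst haa
          have ha : a ≠ 0 := by
            rintro rfl
            exact hm (by rw [← ht.2.1, zero_mul])
          have hb : b = b' := mul_left_cancel₀ ha (ht.2.1.trans ht'.2.1.symm)
          rw [hb, ht.2.2, ht'.2.2]
    _ ≤ 2 * D := by
        rw [Finset.card_product]
        simpa using hmD

/-- Within one residue class, m is determined by its quotient by q, and the quotients lie in an
interval. -/
lemma card_le_of_dvd_sub {q : ℕ} (hq : 0 < q) (L : ℕ) (s : Finset ℤ)
    (hs : ∀ m ∈ s, |m| ≤ L) (hd : ∀ m ∈ s, ∀ m' ∈ s, (q : ℤ) ∣ m - m') :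
    s.card ≤ 2 * L / q + 2 := by
  have hq' : (0 : ℤ) < q := by exact_mod_cast hq
  have h1 : s.card ≤ (Finset.Icc ((-L : ℤ) / q) ((L : ℤ) / q)).card := by
    refine Finset.card_le_card_of_injOn (fun m => m / (q : ℤ)) ?_ ?_
    · intro m hm
      have := abs_le.1 (hs m hm)
      simp only [Finset.coe_Icc, Set.mem_Icc]
      exact ⟨Int.ediv_le_ediv hq' this.1, Int.ediv_le_ediv hq' this.2⟩
    · intro m hm m' hm' h
      have h2 : m ≡ m' [ZMOD q] := ((Int.modEq_iff_dvd).2 (hd m hm m' hm')).symm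
      have h2 : m % q = m' % q := h2
      have h : m / (q : ℤ) = m' / q := h
      rw [← Int.mul_ediv_add_emod m q, ← Int.mul_ediv_add_emod m' q, h, h2]
  refine h1.trans ?_
  rw [Int.card_Icc]
  have e1 := Int.mul_ediv_add_emod (-L : ℤ) q
  have e2 := Int.mul_ediv_add_emod (L : ℤ) q
  have l1 := Int.emod_lt_of_pos (-L : ℤ) hq'
  have l2 := Int.emod_nonneg (L : ℤ) hq'.ne'
  have e3 : (L : ℤ) / q - (-L) / q ≤ (2 * L / q : ℕ) + 1 := by
    rw [← sub_le_iff_le_add]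
    push_cast
    rw [Int.le_ediv_iff_mul_le hq']
    nlinarith
  have e4 := Int.natCast_nonneg (2 * L / q)
  omega

lemma card_le_of_abs_sub_le (w : ℕ) (s : Finset ℤ) (hs : ∀ m ∈ s, ∀ m' ∈ s, m' - m ≤ w) :
    s.card ≤ w + 1 := by
  rcases s.eq_empty_or_nonempty with rfl | hne
  · simp
  calc s.card ≤ (Finset.Icc (s.min' hne) (s.min' hne + w)).card := Finset.card_le_card fun m hm => by
        rw [Finset.mem_Icc]
        exact ⟨s.min'_le m hm, by linarith [hs _ (s.min'_mem hne) m hm]⟩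
    _ = w + 1 := by rw [Int.card_Icc]; omega

/-- The triples `(a, b, c)` with `0 < |a| ≤ X`, `0 < |b| ≤ Y`, `|c| ≤ R`. -/
noncomputable def box (X Y R : ℕ) : Finset (ℤ × ℤ × ℤ) :=
  (Finset.Icc (-X : ℤ) X ×ˢ Finset.Icc (-Y : ℤ) Y ×ˢ Finset.Icc (-R : ℤ) R).filter
    fun t => t.1 * t.2.1 ≠ 0

lemma mem_box {X Y R : ℕ} {t : ℤ × ℤ × ℤ} :
    t ∈ box X Y R ↔ (|t.1| ≤ X ∧ |t.2.1| ≤ Y ∧ |t.2.2| ≤ R) ∧ t.1 * t.2.1 ≠ 0 := by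
  simp [box, abs_le]

lemma card_box_le (X Y R : ℕ) :
    (box X Y R).card ≤ (2 * X + 1) * ((2 * Y + 1) * (2 * R + 1)) := by
  refine (Finset.card_filter_le _ _).trans ?_
  rw [Finset.card_product, Finset.card_product, Int.card_Icc, Int.card_Icc, Int.card_Icc]
  refine Nat.mul_le_mul ?_ (Nat.mul_le_mul ?_ ?_) <;> omega

lemma natAbs_mul_le_of_mem_box {X Y R : ℕ} {t : ℤ × ℤ × ℤ} (ht : t ∈ box X Y R) :
    |t.1 * t.2.1| ≤ ((X * Y : ℕ) : ℤ) := by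
  rw [mem_box] at ht
  rw [abs_mul]
  push_cast
  exact mul_le_mul ht.1.1 ht.1.2.1 (abs_nonneg _) (by positivity)

/-- `D` bounds the number of divisors of every positive integer up to `L`. -/
def DivisorBound (L D : ℕ) : Prop := ∀ m : ℕ, m ≠ 0 → m ≤ L → m.divisors.card ≤ D

lemma DivisorBound.of_mem_box {X Y R D : ℕ} (hD : DivisorBound (X * Y) D) {t : ℤ × ℤ × ℤ}
    (ht : t ∈ box X Y R) : (t.1 * t.2.1).natAbs.divisors.card ≤ D := by
  refine hD _ (by simpa using (mem_box.1 ht).2) ?_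
  have := natAbs_mul_le_of_mem_box ht
  rw [Int.abs_eq_natAbs] at this
  exact_mod_cast this

lemma card_box_congr_le {X Y R D q d : ℕ} (hq : 0 < q) (hd : Nat.Coprime d q)
    (hD : DivisorBound (X * Y) D) :
    ((box X Y R).filter fun t => (q : ℤ) ∣ d * (t.1 * t.2.1) + t.2.2).card ≤
      2 * D * ((2 * (X * Y) / q + 2) * (2 * R + 1)) := by
  set M : Finset (ℤ × ℤ) := (Finset.Icc (-(X * Y : ℕ) : ℤ) (X * Y : ℕ) ×ˢ
    Finset.Icc (-R : ℤ) R).filter fun t => (q : ℤ) ∣ d * t.1 + t.2 with hM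
  refine (card_triples_le _ M D ?_ ?_ ?_).trans ?_
  · intro t ht
    exact (mem_box.1 (Finset.mem_filter.1 ht).1).2
  · intro t ht
    rw [Finset.mem_filter] at ht
    have h1 := abs_le.1 (natAbs_mul_le_of_mem_box ht.1)
    have h2 := abs_le.1 (mem_box.1 ht.1).1.2.2
    rw [hM, Finset.mem_filter, Finset.mem_product, Finset.mem_Icc, Finset.mem_Icc]
    exact ⟨⟨h1, h2⟩, ht.2⟩
  · intro t ht
    exact hD.of_mem_box (Finset.mem_filter.1 ht).1
  · refine Nat.mul_le_mul_left _ ?_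
    have hc : (Finset.Icc (-R : ℤ) R).card = 2 * R + 1 := by rw [Int.card_Icc]; omega
    rw [← hc]
    refine Finset.card_le_mul_card_image_of_maps_to (f := Prod.snd) ?_ _ ?_
    · intro t ht
      exact (Finset.mem_product.1 (Finset.mem_filter.1 ht).1).2
    · intro c _
      rw [← Finset.card_image_of_injOn (f := Prod.fst)]
      · refine card_le_of_dvd_sub hq _ _ ?_ ?_
        · intro m hm
          simp only [Finset.mem_image, Finset.mem_filter, hM, Finset.mem_product,
            Finset.mem_Icc] at hm
          obtain ⟨t, ht, rfl⟩ := hm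
          exact abs_le.2 ht.1.1.1
        · intro m hm m' hm'
          simp only [Finset.mem_image, Finset.mem_filter, hM] at hm hm'
          obtain ⟨t, ht, rfl⟩ := hm
          obtain ⟨t', ht', rfl⟩ := hm'
          have h := dvd_sub ht.1.2 ht'.1.2
          rw [ht.2, ht'.2, add_sub_add_right_eq_sub, ← mul_sub] at h
          -- As d is a unit mod q, the value of c determines the product m mod q.
          exact (Nat.isCoprime_iff_coprime.2 hd).symm.dvd_of_dvd_mul_left h
      · intro t ht t' ht' h
        simp only [Finset.coe_filter, Set.mem_ofPred_eq] at ht ht'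
        exact Prod.ext h (ht.2.trans ht'.2.symm)

/-- For given c the product m lies in an interval of length 2E/|c₀|, and at most 3|c₀| values of c
are allowed. The restriction |c| ≤ |c₀| is what makes the two sizes cancel: (2E/|c₀| + 1)·3|c₀| ≤ 6E
+ 3R. -/
lemma card_box_near_le {X Y R D E : ℕ} (hD : DivisorBound (X * Y) D) (m₀ c₀ : ℤ) (hc₀ : c₀ ≠ 0)
    (hc₀R : |c₀| ≤ R) :
    ((box X Y R).filter fun t => |t.2.2| ≤ |c₀| ∧ |c₀ * (t.1 * t.2.1) - t.2.2 * m₀| ≤ E).card ≤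
      2 * D * (6 * E + 3 * R) := by
  set M : Finset (ℤ × ℤ) := (Finset.Icc (-(X * Y : ℕ) : ℤ) (X * Y : ℕ) ×ˢ
    Finset.Icc (-|c₀|) |c₀|).filter fun t => |c₀ * t.1 - t.2 * m₀| ≤ E with hM
  have hc0 : 0 < c₀.natAbs := Int.natAbs_pos.2 hc₀
  refine (card_triples_le _ M D ?_ ?_ ?_).trans ?_
  · intro t ht
    exact (mem_box.1 (Finset.mem_filter.1 ht).1).2
  · intro t ht
    rw [Finset.mem_filter] at ht
    have h1 := abs_le.1 (natAbs_mul_le_of_mem_box ht.1)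
    have h2 := abs_le.1 ht.2.1
    rw [hM, Finset.mem_filter, Finset.mem_product, Finset.mem_Icc, Finset.mem_Icc]
    exact ⟨⟨h1, h2⟩, ht.2.2⟩
  · intro t ht
    exact hD.of_mem_box (Finset.mem_filter.1 ht).1
  · refine Nat.mul_le_mul_left _ ?_
    have hc : (Finset.Icc (-|c₀|) |c₀|).card = 2 * c₀.natAbs + 1 := by
      rw [Int.card_Icc, Int.abs_eq_natAbs]; omega
    have h1 : M.card ≤ (2 * E / c₀.natAbs + 1) * (Finset.Icc (-|c₀|) |c₀|).card := by
      refine Finset.card_le_mul_card_image_of_maps_to (f := Prod.snd) ?_ _ ?_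
      · intro t ht
        exact (Finset.mem_product.1 (Finset.mem_filter.1 ht).1).2
      · intro c _
        rw [← Finset.card_image_of_injOn (f := Prod.fst)]
        · refine card_le_of_abs_sub_le _ _ ?_
          intro m hm m' hm'
          simp only [Finset.mem_image, Finset.mem_filter, hM] at hm hm'
          obtain ⟨t, ht, rfl⟩ := hm
          obtain ⟨t', ht', rfl⟩ := hm'
          have h := ht.1.2
          have h' := ht'.1.2
          rw [ht.2] at h
          rw [ht'.2] at h'
          push_cast
          rw [Int.le_ediv_iff_mul_le (abs_pos.2 hc₀)]
          have h3 : |c₀ * (t'.1 - t.1)| ≤ 2 * E := by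
            calc |c₀ * (t'.1 - t.1)| = |(c₀ * t'.1 - c * m₀) - (c₀ * t.1 - c * m₀)| := by ring_nf
              _ ≤ _ := abs_sub _ _
              _ ≤ _ := by linarith
          rw [abs_mul, mul_comm] at h3
          refine le_trans ?_ h3
          exact mul_le_mul_of_nonneg_right (le_abs_self _) (abs_nonneg _)
        · intro t ht t' ht' h
          simp only [Finset.coe_filter, Set.mem_ofPred_eq] at ht ht'
          exact Prod.ext h (ht.2.trans ht'.2.symm)
    rw [hc] at h1
    have hR : c₀.natAbs ≤ R := by
      rw [Int.abs_eq_natAbs] at hc₀R; exact_mod_cast hc₀R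
    have h2 := Nat.div_mul_le_self (2 * E) c₀.natAbs
    calc M.card ≤ (2 * E / c₀.natAbs + 1) * (2 * c₀.natAbs + 1) := h1
      _ ≤ (2 * E / c₀.natAbs + 1) * (3 * c₀.natAbs) := Nat.mul_le_mul_left _ (by omega)
      _ = 3 * (2 * E / c₀.natAbs * c₀.natAbs) + 3 * c₀.natAbs := by ring
      _ ≤ _ := by omega

variable {n : ℕ}

/-- The number of units `d` modulo `q` with `d x_k y_k + c_k ≡ 0` for all `k`. -/
def unitCount (q : ℕ) (p : Fin (n + 1) → ℤ × ℤ × ℤ) : ℕ :=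
  ((Finset.range q).filter fun d => Nat.Coprime d q ∧
    ∀ k, (q : ℤ) ∣ d * ((p k).1 * (p k).2.1) + (p k).2.2).card

lemma unitCount_le (q : ℕ) (p : Fin (n + 1) → ℤ × ℤ × ℤ) : unitCount q p ≤ q :=
  (Finset.card_filter_le _ _).trans (Finset.card_range q).le

/-- With the sum over d taken outside, the conditions on the n + 1 coordinates decouple. -/
lemma sum_unitCount_le {X Y R D q : ℕ} (hq : 0 < q) (hD : DivisorBound (X * Y) D) :
    ∑ p ∈ Fintype.piFinset fun _ : Fin (n + 1) => box X Y R, unitCount q p ≤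
      q * (2 * D * ((2 * (X * Y) / q + 2) * (2 * R + 1))) ^ (n + 1) := by
  simp only [unitCount, Finset.card_filter]
  rw [Finset.sum_comm]
  calc _ ≤ ∑ d ∈ Finset.range q, (2 * D * ((2 * (X * Y) / q + 2) * (2 * R + 1))) ^ (n + 1) := by
        refine Finset.sum_le_sum fun d _ => ?_
        rw [← Finset.card_filter]
        by_cases hd : Nat.Coprime d q
        · calc _ ≤ (Fintype.piFinset fun _ : Fin (n + 1) => (box X Y R).filter
                fun t => (q : ℤ) ∣ d * (t.1 * t.2.1) + t.2.2).card := by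
                refine Finset.card_le_card fun p hp => ?_
                rw [Finset.mem_filter, Fintype.mem_piFinset] at hp
                rw [Fintype.mem_piFinset]
                exact fun k => Finset.mem_filter.2 ⟨hp.1 k, hp.2.2 k⟩
            _ ≤ _ := by
                rw [Fintype.card_piFinset, Finset.prod_const, Finset.card_univ, Fintype.card_fin]
                exact Nat.pow_le_pow_left (card_box_congr_le hq hd hD) _
        · simp [hd]
    _ = _ := by rw [Finset.sum_const, Finset.card_range, smul_eq_mul]

/-- Let k be a coordinate with |c_k| maximal, hence nonzero. Its triple ranges over the whole box,
and the minors with k confine each other triple as in `card_box_near_le`. -/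
lemma card_near_le {X Y R D E : ℕ} (hD : DivisorBound (X * Y) D) :
    ((Fintype.piFinset fun _ : Fin (n + 1) => box X Y R).filter fun p =>
      (∃ k, (p k).2.2 ≠ 0) ∧ ∀ k l, |(p k).2.2 * ((p l).1 * (p l).2.1) -
        (p l).2.2 * ((p k).1 * (p k).2.1)| ≤ (E : ℤ)).card ≤
      (n + 1) * ((box X Y R).card * (2 * D * (6 * E + 3 * R)) ^ n) := by
  classical
  set T : ℤ × ℤ × ℤ → Finset (ℤ × ℤ × ℤ) := fun v => (box X Y R).filter fun t =>
    |t.2.2| ≤ |v.2.2| ∧ |v.2.2 * (t.1 * t.2.1) - t.2.2 * (v.1 * v.2.1)| ≤ E with hT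
  set V := (box X Y R).filter fun v => v.2.2 ≠ 0 with hV
  calc _ ≤ ((Finset.univ : Finset (Fin (n + 1))).biUnion fun k => V.biUnion fun v =>
        Fintype.piFinset fun l => if l = k then {v} else T v).card := by
        refine Finset.card_le_card fun p hp => ?_
        rw [Finset.mem_filter, Fintype.mem_piFinset] at hp
        obtain ⟨hp, ⟨k₁, hk₁⟩, hE⟩ := hp
        obtain ⟨k, -, hk⟩ := Finset.exists_max_image Finset.univ (fun k => |(p k).2.2|)
          ⟨k₁, Finset.mem_univ _⟩
        have hk0 : (p k).2.2 ≠ 0 :=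
          abs_pos.1 ((abs_pos.2 hk₁).trans_le (hk k₁ (Finset.mem_univ _)))
        simp only [Finset.mem_biUnion, Finset.mem_univ, true_and]
        refine ⟨k, p k, Finset.mem_filter.2 ⟨hp k, hk0⟩, Fintype.mem_piFinset.2 fun l => ?_⟩
        split_ifs with h
        · rw [h, Finset.mem_singleton]
        · exact Finset.mem_filter.2 ⟨hp l, hk l (Finset.mem_univ _), hE k l⟩
    _ ≤ ∑ k : Fin (n + 1), ∑ v ∈ V,
        (Fintype.piFinset fun l => if l = k then {v} else T v).card :=
        Finset.card_biUnion_le.trans (Finset.sum_le_sum fun k _ => Finset.card_biUnion_le)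
    _ ≤ ∑ k : Fin (n + 1), ∑ v ∈ V, (2 * D * (6 * E + 3 * R)) ^ n := by
        refine Finset.sum_le_sum fun k _ => Finset.sum_le_sum fun v hv => ?_
        rw [hV, Finset.mem_filter] at hv
        rw [Fintype.card_piFinset, ← Finset.mul_prod_erase _ _ (Finset.mem_univ k), if_pos rfl,
          Finset.card_singleton, one_mul]
        calc _ ≤ ∏ l ∈ Finset.univ.erase k, (2 * D * (6 * E + 3 * R)) := by
              refine Finset.prod_le_prod' fun l hl => ?_
              rw [if_neg (Finset.ne_of_mem_erase hl)]
              exact card_box_near_le hD _ _ hv.2 (mem_box.1 hv.1).1.2.2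
          _ = _ := by rw [Finset.prod_const, Finset.card_erase_of_mem (Finset.mem_univ k)]; simp
    _ ≤ _ := by
        rw [Finset.sum_const, Finset.sum_const, Finset.card_univ, Fintype.card_fin, smul_eq_mul,
          smul_eq_mul]
        gcongr
        exact Finset.filter_subset _ _

/-! ### The exponential sums -/

lemma e_add (x y : ℝ) : e (x + y) = e x * e y := by
  unfold e
  rw [← Complex.exp_add]
  congr 1
  push_cast
  ring

lemma e_zero : e 0 = 1 := by simp [e]

lemma e_sum {ι : Type*} (s : Finset ι) (f : ι → ℝ) : e (∑ k ∈ s, f k) = ∏ k ∈ s, e (f k) := by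
  classical
  induction s using Finset.induction_on with
  | empty => simp [e_zero]
  | insert a s ha ih => rw [Finset.sum_insert ha, Finset.prod_insert ha, e_add, ih]

lemma e_natCast_mul (b : ℕ) (x : ℝ) : e (b * x) = e x ^ b := by
  unfold e
  rw [← Complex.exp_nat_mul]
  congr 1
  push_cast
  ring

lemma e_intCast (a : ℤ) : e a = 1 := by
  unfold e
  rw [Complex.exp_eq_one_iff]
  exact ⟨a, by push_cast; ring⟩

lemma dvd_of_e_div_eq_one {q : ℕ} (hq : q ≠ 0) {a : ℤ} (h : e (a / q) = 1) : (q : ℤ) ∣ a := by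
  unfold e at h
  rw [Complex.exp_eq_one_iff] at h
  obtain ⟨m, hm⟩ := h
  have h2 : (2 * Real.pi * Complex.I : ℂ) ≠ 0 := Complex.two_pi_I_ne_zero
  rw [mul_comm] at hm
  have h3 := mul_right_cancel₀ h2 hm
  have h4 : (a : ℝ) / q = m := by exact_mod_cast h3
  rw [div_eq_iff (by exact_mod_cast hq)] at h4
  exact ⟨m, by rw [mul_comm]; exact_mod_cast h4⟩

lemma sum_e_eq_zero {q : ℕ} (hq : q ≠ 0) {a : ℤ} (ha : ¬ (q : ℤ) ∣ a) :
    ∑ b : Fin q, e ((a : ℝ) * ((b : ℕ) : ℝ) / q) = 0 := by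
  have h1 : ∀ b : Fin q, e ((a : ℝ) * ((b : ℕ) : ℝ) / q) = e ((a : ℝ) / q) ^ (b : ℕ) := fun b => by
    rw [← e_natCast_mul]; congr 1; ring
  simp_rw [h1]
  rw [Fin.sum_univ_eq_sum_range (fun b => e ((a : ℝ) / q) ^ b),
    geom_sum_eq (fun h => ha (dvd_of_e_div_eq_one hq h)), ← e_natCast_mul]
  have : (q : ℝ) * (a / q) = a := by
    have : (q : ℝ) ≠ 0 := by exact_mod_cast hq
    field_simp
  rw [this, e_intCast, sub_self, zero_div]

lemma norm_sum_vector_e_le {n q : ℕ} (hq : q ≠ 0) (a : Fin (n + 1) → ℤ) :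
    ‖∑ b : Fin (n + 1) → Fin q, e (∑ k, (a k : ℝ) * ((b k : ℕ) : ℝ) / q)‖ ≤
      if ∀ k, (q : ℤ) ∣ a k then (q : ℝ) ^ (n + 1) else 0 := by
  have h1 : ∑ b : Fin (n + 1) → Fin q, e (∑ k, (a k : ℝ) * ((b k : ℕ) : ℝ) / q) =
      ∏ k, ∑ b : Fin q, e ((a k : ℝ) * ((b : ℕ) : ℝ) / q) := by
    rw [Finset.prod_univ_sum, Fintype.piFinset_univ]
    exact Finset.sum_congr rfl fun b _ => e_sum _ _
  split_ifs with h
  · rw [h1, norm_prod]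
    calc _ ≤ ∏ _k : Fin (n + 1), (q : ℝ) := by
          refine Finset.prod_le_prod (fun _ _ => norm_nonneg _) fun k _ => ?_
          refine (norm_sum_le _ _).trans ?_
          simp [norm_e]
      _ = _ := by simp
  · push Not at h
    obtain ⟨k, hk⟩ := h
    rw [h1, Finset.prod_eq_zero (Finset.mem_univ k) (sum_e_eq_zero hq hk), norm_zero]

/-- For fixed d the sum over b is a product of n + 1 complete geometric sums; it vanishes unless q
divides every d x_k y_k + c_k. -/
lemma norm_S_le {n q : ℕ} (hq : q ≠ 0) (x y c : Fin (n + 1) → ℤ) :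
    ‖((q : ℂ) ^ (n + 1))⁻¹ * S q x y c‖ ≤ unitCount q fun k => (x k, y k, c k) := by
  have hq0 : (0 : ℝ) < (q : ℝ) ^ (n + 1) := by positivity
  rw [norm_mul, norm_inv, norm_pow, Complex.norm_natCast, inv_mul_le_iff₀ hq0]
  unfold S unitCount
  refine (norm_sum_le _ _).trans ?_
  rw [← Finset.filter_filter, Finset.card_filter, Nat.cast_sum, Finset.mul_sum]
  refine Finset.sum_le_sum fun d _ => ?_
  have h := norm_sum_vector_e_le hq (fun k => (d : ℤ) * (x k * y k) + c k)
  have h2 : ∀ b : Fin (n + 1) → Fin q, e (((d : ℝ) * ∑ k, (x k : ℝ) * (y k : ℝ) * ((b k : ℕ) : ℝ)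
        + ∑ k, (c k : ℝ) * ((b k : ℕ) : ℝ)) / (q : ℝ)) =
      e (∑ k, (((d : ℤ) * (x k * y k) + c k : ℤ) : ℝ) * ((b k : ℕ) : ℝ) / q) := by
    intro b
    congr 1
    rw [← Finset.sum_div, Finset.mul_sum, ← Finset.sum_add_distrib]
    congr 1
    refine Finset.sum_congr rfl fun k _ => ?_
    push_cast
    ring
  simp_rw [h2]
  refine h.trans (le_of_eq ?_)
  split_ifs <;> simp

/-! ### Boundedness of c_Q -/

lemma h_zero_term (x : ℝ) (j : ℕ) :
    1 / (x * (j + 1)) * (omega (x * (j + 1)) - omega (|0| / (x * (j + 1)))) =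
      1 / (x * (j + 1)) * omega (x * (j + 1)) := by
  rw [abs_zero, zero_div, omega_eq_zero (x := 0) (Or.inl (by norm_num)), sub_zero]

lemma summable_h_zero {x : ℝ} (hx : 0 < x) :
    Summable fun j : ℕ => 1 / (x * (j + 1)) * omega (x * (j + 1)) := by
  obtain ⟨J, hJ⟩ := exists_nat_ge (1 / x)
  refine summable_of_ne_finset_zero (s := Finset.range J) fun j hj => ?_
  rw [omega_eq_zero, mul_zero]
  right
  have hj : (J : ℝ) ≤ j := by exact_mod_cast not_lt.1 (fun hh => hj (Finset.mem_range.2 hh))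
  rw [div_le_iff₀' hx] at hJ
  have h1 : x * J ≤ x * (j + 1 : ℝ) := by gcongr; linarith
  linarith

lemma h_zero_nonneg {x : ℝ} (hx : 0 ≤ x) : 0 ≤ h x 0 := by
  unfold h
  refine tsum_nonneg fun j => ?_
  rw [h_zero_term]
  have := omega_nonneg (x * (j + 1))
  positivity

lemma h_zero_eq_zero {x : ℝ} (hx : 1 ≤ x) : h x 0 = 0 := by
  unfold h
  simp_rw [h_zero_term]
  refine (tsum_congr fun j : ℕ => ?_).trans tsum_zero
  rw [omega_eq_zero, mul_zero]
  right
  have : (0 : ℝ) ≤ j := j.cast_nonneg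
  nlinarith

lemma sum_multiples_le_h_zero {Q : ℝ} (hQ : 0 < Q) {q : ℕ} (hq : 0 < q) (M : ℕ) :
    ∑ m ∈ (Finset.Icc 1 M).filter (fun m => q ∣ m), Q / m * omega (m / Q) ≤ h (q / Q) 0 := by
  have hqr : (0 : ℝ) < q := by exact_mod_cast hq
  unfold h
  simp_rw [h_zero_term]
  have hsum := summable_h_zero (x := q / Q) (by positivity)
  have hinj : Set.InjOn (fun m => m / q - 1)
      ((Finset.Icc 1 M).filter (fun m => q ∣ m) : Set ℕ) := by
    intro m hm m' hm' heq
    simp only [Finset.coe_filter, Finset.mem_Icc, Set.mem_ofPred_eq] at hm hm' heq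
    have h1 := Nat.div_pos (Nat.le_of_dvd hm.1.1 hm.2) hq
    have h2 := Nat.div_pos (Nat.le_of_dvd hm'.1.1 hm'.2) hq
    have h3 : m / q = m' / q := by omega
    rw [← Nat.div_mul_cancel hm.2, ← Nat.div_mul_cancel hm'.2, h3]
  -- The multiple m = q(j+1) matches the index j = m/q - 1 of the series for h(q/Q, 0).
  refine le_trans (le_of_eq ?_) (hsum.sum_le_tsum
    (((Finset.Icc 1 M).filter (fun m => q ∣ m)).image fun m => m / q - 1) fun j _ => ?_)
  · rw [Finset.sum_image hinj]
    refine Finset.sum_congr rfl fun m hm => ?_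
    rw [Finset.mem_filter, Finset.mem_Icc] at hm
    obtain ⟨r, rfl⟩ := hm.2
    have hr : 0 < r := Nat.pos_of_ne_zero (by rintro rfl; simp at hm)
    have e1 : ((q * r / q - 1 : ℕ) : ℝ) + 1 = r := by
      rw [Nat.mul_div_cancel_left _ hq]
      have : ((r - 1 + 1 : ℕ) : ℝ) = r := by rw [Nat.sub_add_cancel hr]
      exact_mod_cast this
    rw [e1]
    have hr' : (0 : ℝ) < r := by exact_mod_cast hr
    push_cast
    rw [div_mul_eq_mul_div (q : ℝ) Q r, one_div_div]
  · have := omega_nonneg (q / Q * (j + 1))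
    positivity

/-- Grouping by m = q(j+1) and using ∑_{q ∣ m} φ(q) = m turns the totient sum into Q ∑ ω(m/Q). Only
the lower bound is needed, to keep c_Q from being large. -/
lemma mul_sum_omega_le {Q : ℝ} (hQ : 0 < Q) (M : ℕ) :
    Q * ∑ m ∈ Finset.Icc 1 M, omega (m / Q) ≤ ∑' q : ℕ, (Nat.totient q : ℝ) * h (q / Q) 0 := by
  have hsum : Summable fun q : ℕ => (Nat.totient q : ℝ) * h (q / Q) 0 := by
    refine summable_of_ne_finset_zero (s := Finset.range ⌈Q⌉₊) fun q hq => ?_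
    rw [Finset.mem_range, not_lt, Nat.ceil_le] at hq
    rw [h_zero_eq_zero ((one_le_div hQ).2 hq), mul_zero]
  refine le_trans ?_ (hsum.sum_le_tsum (Finset.Icc 1 M) fun q _ =>
    mul_nonneg (Nat.cast_nonneg _) (h_zero_nonneg (by positivity)))
  calc Q * ∑ m ∈ Finset.Icc 1 M, omega (m / Q)
      = ∑ m ∈ Finset.Icc 1 M, (∑ q ∈ m.divisors, (Nat.totient q : ℝ)) * (Q / m * omega (m / Q)) := by
        rw [Finset.mul_sum]
        refine Finset.sum_congr rfl fun m hm => ?_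
        have hm' : (m : ℝ) ≠ 0 := by
          have := (Finset.mem_Icc.1 hm).1
          positivity
        rw [← Nat.cast_sum, Nat.sum_totient]
        field_simp
    _ = ∑ m ∈ Finset.Icc 1 M, ∑ q ∈ Finset.Icc 1 M,
          if q ∣ m then (Nat.totient q : ℝ) * (Q / m * omega (m / Q)) else 0 := by
        refine Finset.sum_congr rfl fun m hm => ?_
        rw [Finset.sum_mul, ← Finset.sum_filter]
        refine Finset.sum_congr ?_ fun _ _ => rfl
        ext q
        rw [Finset.mem_Icc] at hm
        rw [Nat.mem_divisors, Finset.mem_filter, Finset.mem_Icc]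
        constructor
        · intro hq
          exact ⟨⟨Nat.pos_of_dvd_of_pos hq.1 hm.1, (Nat.le_of_dvd hm.1 hq.1).trans hm.2⟩, hq.1⟩
        · intro hq
          exact ⟨hq.2, by omega⟩
    _ = ∑ q ∈ Finset.Icc 1 M, (Nat.totient q : ℝ) *
          ∑ m ∈ (Finset.Icc 1 M).filter (fun m => q ∣ m), Q / m * omega (m / Q) := by
        rw [Finset.sum_comm]
        refine Finset.sum_congr rfl fun q _ => ?_
        rw [Finset.mul_sum, Finset.sum_filter]
    _ ≤ _ := by
        refine Finset.sum_le_sum fun q hq => ?_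
        gcongr
        exact sum_multiples_le_h_zero hQ (Finset.mem_Icc.1 hq).1 M

lemma le_omega {x : ℝ} (h₁ : 5 / 8 ≤ x) (h₂ : x ≤ 7 / 8) :
    4 * c0⁻¹ * Real.exp (-(4 / 3)) ≤ omega x := by
  have h3 : |4 * x - 3| ≤ 1 / 2 := abs_le.2 ⟨by linarith, by linarith⟩
  unfold omega omega0
  rw [if_pos (by linarith)]
  have h4 : (4 * x - 3) ^ 2 ≤ 1 / 4 := by
    rw [← sq_abs]
    have := abs_nonneg (4 * x - 3)
    nlinarith
  have := c0_pos
  gcongr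
  rw [inv_le_comm₀ (by linarith) (by norm_num)]
  linarith

/-- The constants `cQ` are bounded for large `Q`. -/
lemma exists_abs_cQ_le : ∃ C, ∀ Q : ℝ, 8 ≤ Q → |cQ Q| ≤ C := by
  set κ := 4 * c0⁻¹ * Real.exp (-(4 / 3)) with hκ
  have hκ0 : 0 < κ := by have := c0_pos; positivity
  refine ⟨(κ / 8)⁻¹, fun Q hQ => ?_⟩
  have hQ0 : 0 < Q := by linarith
  have h1 := mul_sum_omega_le hQ0 ⌊Q⌋₊
  have hsub : Finset.Icc ⌈5 / 8 * Q⌉₊ ⌊7 / 8 * Q⌋₊ ⊆ Finset.Icc 1 ⌊Q⌋₊ := by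
    refine Finset.Icc_subset_Icc (Nat.one_le_ceil_iff.2 (by positivity)) ?_
    exact Nat.floor_le_floor (by linarith)
  -- The interval [5Q/8, 7Q/8] contains at least Q/4 - 1 integers, and Q/4 - 1 ≥ Q/8 exactly when Q
  -- ≥ 8.
  have hcard : Q / 8 ≤ ((Finset.Icc ⌈5 / 8 * Q⌉₊ ⌊7 / 8 * Q⌋₊).card : ℝ) := by
    rw [Nat.card_Icc]
    have h2 := Nat.lt_floor_add_one (7 / 8 * Q)
    have h3 := Nat.ceil_lt_add_one (show 0 ≤ 5 / 8 * Q by positivity)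
    have h4 : ((⌊7 / 8 * Q⌋₊ + 1 : ℕ) : ℝ) ≤
        ((⌊7 / 8 * Q⌋₊ + 1 - ⌈5 / 8 * Q⌉₊ : ℕ) : ℝ) + ⌈5 / 8 * Q⌉₊ := by
      exact_mod_cast (by omega)
    push_cast at h4
    linarith
  have h2 : Q / 8 * κ ≤ ∑ m ∈ Finset.Icc 1 ⌊Q⌋₊, omega (m / Q) := by
    calc Q / 8 * κ ≤ ∑ m ∈ Finset.Icc ⌈5 / 8 * Q⌉₊ ⌊7 / 8 * Q⌋₊, κ := by
          rw [Finset.sum_const, nsmul_eq_mul]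
          gcongr
      _ ≤ ∑ m ∈ Finset.Icc ⌈5 / 8 * Q⌉₊ ⌊7 / 8 * Q⌋₊, omega (m / Q) := by
          refine Finset.sum_le_sum fun m hm => le_omega ?_ ?_
          · rw [le_div_iff₀ hQ0]
            exact Nat.ceil_le.1 (Finset.mem_Icc.1 hm).1
          · rw [div_le_iff₀ hQ0]
            exact (Nat.le_floor_iff (by positivity)).1 (Finset.mem_Icc.1 hm).2
      _ ≤ _ := Finset.sum_le_sum_of_subset_of_nonneg hsub fun m _ _ => omega_nonneg _
  have h3 : κ / 8 ≤ Q⁻¹ ^ 2 * ∑' q : ℕ, (Nat.totient q : ℝ) * h (q / Q) 0 := by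
    calc κ / 8 = Q⁻¹ ^ 2 * (Q * (Q / 8 * κ)) := by field_simp
      _ ≤ Q⁻¹ ^ 2 * (Q * ∑ m ∈ Finset.Icc 1 ⌊Q⌋₊, omega (m / Q)) := by gcongr
      _ ≤ _ := by gcongr
  have hpos : 0 < κ / 8 := by positivity
  unfold cQ
  rw [abs_of_pos (inv_pos.2 (hpos.trans_le h3))]
  exact inv_anti₀ hpos h3

/-! ### Major and negligible configurations -/

/-- A summable weight on `ℤⁿ⁺¹`. -/
noncomputable def weight (c : Fin (n + 1) → ℤ) : ℝ := ∏ k, ((1 + |(c k : ℝ)|) ^ 2)⁻¹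

lemma weight_nonneg (c : Fin (n + 1) → ℤ) : 0 ≤ weight c :=
  Finset.prod_nonneg fun _ _ => by positivity

lemma inv_pow_le_weight (c : Fin (n + 1) → ℤ) {t : ℝ} (ht : 1 ≤ t) (hc : ∀ k, |(c k : ℝ)| ≤ t) :
    (t ^ (2 * (n + 1)))⁻¹ ≤ 2 ^ (2 * (n + 1)) * weight c := by
  have h : ∏ k : Fin (n + 1), ((2 * t) ^ 2)⁻¹ ≤ weight c := by
    refine Finset.prod_le_prod (fun _ _ => by positivity) fun k _ => ?_
    have := hc k
    have h0 := abs_nonneg (c k : ℝ)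
    gcongr
    linarith
  rw [Finset.prod_const, Finset.card_univ, Fintype.card_fin] at h
  calc (t ^ (2 * (n + 1)))⁻¹ = 2 ^ (2 * (n + 1)) * (((2 * t) ^ 2)⁻¹) ^ (n + 1) := by
        rw [inv_pow, ← pow_mul, mul_pow]
        have : (t ^ (2 * (n + 1))) ≠ 0 := by positivity
        field_simp
    _ ≤ _ := by gcongr

lemma exists_sum_weight_le (n : ℕ) :
    ∃ W : ℝ, 0 ≤ W ∧ ∀ s : Finset (Fin (n + 1) → ℤ), ∑ c ∈ s, weight c ≤ W := by
  have hs : Summable fun j : ℤ => ((1 + |(j : ℝ)|) ^ 2)⁻¹ := by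
    have hn : Summable fun j : ℕ => ((1 + (j : ℝ)) ^ 2)⁻¹ := by
      have := (summable_nat_add_iff 1).2 (Real.summable_nat_pow_inv.2 one_lt_two)
      refine this.congr fun j => ?_
      push_cast
      rw [add_comm]
    refine Summable.of_nat_of_neg (hn.congr fun j => ?_) (hn.congr fun j => ?_) <;> simp
  refine ⟨(∑' j : ℤ, ((1 + |(j : ℝ)|) ^ 2)⁻¹) ^ (n + 1),
    pow_nonneg (tsum_nonneg fun _ => by positivity) _, fun s => ?_⟩
  set T : Finset ℤ := s.biUnion fun c => Finset.univ.image c with hT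
  calc ∑ c ∈ s, weight c ≤ ∑ c ∈ Fintype.piFinset fun _ : Fin (n + 1) => T, weight c := by
        refine Finset.sum_le_sum_of_subset_of_nonneg (fun c hc => ?_) fun c _ _ => weight_nonneg c
        rw [Fintype.mem_piFinset]
        exact fun k => Finset.mem_biUnion.2 ⟨c, hc, Finset.mem_image_of_mem _ (Finset.mem_univ k)⟩
    _ = ∏ _k : Fin (n + 1), ∑ j ∈ T, ((1 + |(j : ℝ)|) ^ 2)⁻¹ :=
        (Finset.prod_univ_sum (fun _ => T) fun _ j => ((1 + |(j : ℝ)|) ^ 2)⁻¹).symm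
    _ = (∑ j ∈ T, ((1 + |(j : ℝ)|) ^ 2)⁻¹) ^ (n + 1) := by simp
    _ ≤ _ := by
        refine pow_le_pow_left₀ (Finset.sum_nonneg fun _ _ => by positivity) ?_ _
        exact hs.sum_le_tsum _ fun _ _ => by positivity

/-- The frequencies `c` that are not negligible are bounded by this. -/
noncomputable def radius (B : ℝ) (L : ℕ) : ℕ := ⌊B ^ (1 / 1000 : ℝ) * L / √B⌋₊

/-- The minors of `(c, xy)` that are not negligible are bounded by this. -/
noncomputable def minorBound (B : ℝ) (L q : ℕ) : ℕ := ⌊q * (L : ℝ) ^ 2 * B ^ (1 / 1000 : ℝ) / B⌋₊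

/-- The triples for which the integral is not negligible. -/
def IsMajor (B : ℝ) (L q : ℕ) (p : Fin (n + 1) → ℤ × ℤ × ℤ) : Prop :=
  (∀ k, |(p k).2.2| ≤ (radius B L : ℤ)) ∧ ((q : ℝ) ≤ B ^ (1 / 4 : ℝ) → ∀ k l,
    |(p k).2.2 * ((p l).1 * (p l).2.1) - (p l).2.2 * ((p k).1 * (p k).2.1)| ≤
      (minorBound B L q : ℤ))

lemma lt_of_floor_lt_abs {u : ℝ} {a : ℤ} (h : (⌊u⌋₊ : ℤ) < |a|) : u < |(a : ℝ)| := by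
  have h1 : ((⌊u⌋₊ : ℤ) + 1 : ℤ) ≤ |a| := h
  have h2 : ((⌊u⌋₊ : ℝ) + 1) ≤ |(a : ℝ)| := by exact_mod_cast h1
  exact (Nat.lt_floor_add_one u).trans_le h2

lemma I_eq {ε B : ℝ} {i₀ j₀ : Fin (n + 1)} {q : ℕ} {x y c : Fin (n + 1) → ℤ} :
    I ε B i₀ j₀ q x y c = (cQ (√B) : ℂ) * ∫ z : Fin (n + 1) → ℝ,
      (amplitude ε (B / ((x i₀ : ℝ) * (y j₀ : ℝ))) (√B) q
        (fun k => (x k : ℝ) * (y k : ℝ)) z : ℂ) * e (-(∑ k, (c k : ℝ) * z k) / q) := rfl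

/-- A gain of B^{1/1000}, however small, becomes any power of B after enough integrations by parts.
-/
lemma pow_le_rpow_neg {B u : ℝ} (hB : 1 ≤ B) (hu : 0 ≤ u) (huB : u * B ^ (1 / 1000 : ℝ) ≤ 1)
    (M : ℕ) : u ^ (1000 * M) ≤ (B ^ M)⁻¹ := by
  have hB0 : 0 < B := by linarith
  have h1 : u ≤ (B ^ (1 / 1000 : ℝ))⁻¹ := by
    rw [← one_div, le_div_iff₀ (by positivity)]; exact huB
  calc u ^ (1000 * M) ≤ ((B ^ (1 / 1000 : ℝ))⁻¹) ^ (1000 * M) := by gcongr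
    _ = (B ^ M)⁻¹ := by
      rw [inv_pow, pow_mul, ← Real.rpow_natCast (B ^ (1 / 1000 : ℝ)), ← Real.rpow_mul hB0.le]
      norm_num

lemma rpow_sixth_facts {B : ℝ} {L : ℕ} (hB : 1 ≤ B) (hL : (L : ℝ) ≤ B ^ (2 / 3 : ℝ)) :
    (L : ℝ) / √B ≤ B ^ (1 / 6 : ℝ) := by
  have hB0 : 0 < B := by linarith
  rw [Real.sqrt_eq_rpow, div_le_iff₀ (by positivity), ← Real.rpow_add hB0]
  norm_num
  exact hL

/-- If a minor or some c_k exceeds its threshold, each integration by parts gains at least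
B^{1/1000}, up to a constant. The first 1000(2(n+1) + 3) of them give B^{-3} · B^{-2(n+1)}. If all
|c_k| ≤ B, the last factor is already dominated by the weight; if max |c_k| = t is past the radius,
the remaining 2(n+1) integrations supply (B/t)^{2(n+1)}, which converts it into t^{-2(n+1)}. -/
lemma norm_integral_le_of_not_isMajor {B K F A J : ℝ} {L q : ℕ} (hB : 1 ≤ B) (hK : 0 < K)
    (hF : 0 ≤ F) (hA : 0 ≤ A) (hL1 : 1 ≤ L) (hL : (L : ℝ) ≤ B ^ (2 / 3 : ℝ))
    (hq : 1 ≤ q) (hqK : (q : ℝ) ≤ K * √B) (p : Fin (n + 1) → ℤ × ℤ × ℤ)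
    (hp : ∀ k, |((p k).1 : ℝ) * (p k).2.1| ≤ L) {N : ℕ}
    (hN : N = 1000 * (2 * (n + 1) + 3) + 2 * (n + 1))
    (h₁ : ∀ k, |((p k).2.2 : ℝ)| ^ N * J ≤
      A * F * (q / (B / L) + |((p k).1 : ℝ) * (p k).2.1| / √B) ^ N)
    (h₂ : ∀ k l, k ≠ l → |((p k).2.2 : ℝ) * ((p l).1 * (p l).2.1) -
      (p l).2.2 * ((p k).1 * (p k).2.1)| ^ N * J ≤
      A * F * (q * (|((p k).1 : ℝ) * (p k).2.1| + |((p l).1 : ℝ) * (p l).2.1|) / (B / L)) ^ N)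
    (hbad : ¬ IsMajor B L q p) :
    J ≤ A * F * ((K + 2) ^ N * 2 ^ (2 * (n + 1))) *
      ((B ^ 3)⁻¹ * weight fun k => (p k).2.2) := by
  have hB0 : 0 < B := by linarith
  have hQ0 : 0 < √B := Real.sqrt_pos.2 hB0
  have hL0 : (0 : ℝ) < L := by exact_mod_cast hL1
  have hQQ : √B * √B = B := Real.mul_self_sqrt hB0.le
  set β : ℝ := B ^ (1 / 1000 : ℝ) with hβ
  have hβ1 : 1 ≤ β := Real.one_le_rpow hB (by norm_num)
  set ρ : ℝ := L / √B with hρ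
  have hρ0 : 0 < ρ := by positivity
  have hρ6 : ρ ≤ B ^ (1 / 6 : ℝ) := rpow_sixth_facts hB hL
  have hρB : ρ ≤ B := hρ6.trans (by
    conv_rhs => rw [← Real.rpow_one B]
    exact Real.rpow_le_rpow_of_exponent_le hB (by norm_num))
  set w := weight fun k => (p k).2.2 with hw
  have hw0 : 0 ≤ w := weight_nonneg _
  have hBpow : B ^ (2 * (n + 1)) * (B ^ (2 * (n + 1) + 3))⁻¹ = (B ^ 3)⁻¹ := by
    rw [pow_add]; field_simp
  by_cases hc : ∀ k, |(p k).2.2| ≤ (radius B L : ℤ)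
  · have hmin : ¬ ((q : ℝ) ≤ B ^ (1 / 4 : ℝ) → ∀ k l, |(p k).2.2 * ((p l).1 * (p l).2.1) -
        (p l).2.2 * ((p k).1 * (p k).2.1)| ≤ (minorBound B L q : ℤ)) := fun h => hbad ⟨hc, h⟩
    push Not at hmin
    obtain ⟨-, k, l, hkl⟩ := hmin
    have hkl' := lt_of_floor_lt_abs hkl
    -- The minor with k = l is zero and cannot exceed the bound.
    have hne : k ≠ l := by
      rintro rfl
      rw [sub_self, abs_zero] at hkl
      omega
    have h := h₂ k l hne
    push_cast at hkl'
    set Δ := |((p k).2.2 : ℝ) * ((p l).1 * (p l).2.1) - (p l).2.2 * ((p k).1 * (p k).2.1)| with hΔ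
    have hΔ0 : 0 < Δ := lt_of_le_of_lt (by positivity) hkl'
    have hpp : |((p k).1 : ℝ) * (p k).2.1| + |((p l).1 : ℝ) * (p l).2.1| ≤ 2 * L := by
      linarith [hp k, hp l]
    set V := q * (L : ℝ) ^ 2 / B with hV
    have hV0 : 0 ≤ V := by positivity
    have hVΔ : V * β ≤ Δ := le_trans (le_of_eq (by rw [hV]; ring)) hkl'.le
    have hu : V / Δ * β ≤ 1 := by
      rw [div_mul_eq_mul_div, div_le_one hΔ0]; exact hVΔ
    have hu1 : V / Δ ≤ 1 := by
      have : 0 ≤ V / Δ := by positivity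
      nlinarith
    have hcB : ∀ k, |((p k).2.2 : ℝ)| ≤ B := by
      intro k
      have h3 : |((p k).2.2 : ℝ)| ≤ (radius B L : ℝ) := by exact_mod_cast hc k
      have h4 : (radius B L : ℝ) ≤ β * L / √B := Nat.floor_le (by positivity)
      calc |((p k).2.2 : ℝ)| ≤ β * ρ := by rw [hρ, ← mul_div_assoc]; linarith
        _ ≤ B ^ (1 / 1000 : ℝ) * B ^ (1 / 6 : ℝ) := by gcongr
        _ ≤ B ^ (1 : ℝ) := by
          rw [← Real.rpow_add hB0]
          exact Real.rpow_le_rpow_of_exponent_le hB (by norm_num)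
        _ = B := Real.rpow_one B
    have hwB := inv_pow_le_weight _ hB hcB
    have h5 : J ≤ A * F * (2 * (V / Δ)) ^ N := by
      have h6 : Δ ^ N * J ≤ A * F * (2 * V) ^ N := by
        refine h.trans ?_
        gcongr
        calc _ ≤ q * (2 * L) / (B / L) := by gcongr
          _ = 2 * V := by rw [hV]; field_simp
      rw [← mul_div_assoc, div_pow, ← mul_div_assoc, le_div_iff₀ (by positivity), mul_comm]
      exact h6
    refine h5.trans ?_
    rw [mul_pow, mul_assoc (A * F)]
    refine mul_le_mul_of_nonneg_left ?_ (by positivity)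
    have h7 : (V / Δ) ^ N ≤ (B ^ 3)⁻¹ * (2 ^ (2 * (n + 1)) * w) := by
      calc (V / Δ) ^ N ≤ (V / Δ) ^ (1000 * (2 * (n + 1) + 3)) :=
            pow_le_pow_of_le_one (by positivity) hu1 (by omega)
        _ ≤ (B ^ (2 * (n + 1) + 3))⁻¹ := pow_le_rpow_neg hB (by positivity) hu _
        _ = (B ^ 3)⁻¹ * (B ^ (2 * (n + 1)))⁻¹ := by rw [pow_add, mul_inv, mul_comm]
        _ ≤ _ := by gcongr
    calc 2 ^ N * (V / Δ) ^ N ≤ (K + 2) ^ N * ((B ^ 3)⁻¹ * (2 ^ (2 * (n + 1)) * w)) := by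
          gcongr
          linarith
      _ = _ := by ring
  · push Not at hc
    obtain ⟨k₁, hk₁⟩ := hc
    obtain ⟨k, -, hk⟩ := Finset.exists_max_image Finset.univ (fun k => |(p k).2.2|)
      ⟨k₁, Finset.mem_univ _⟩
    have hkR : (radius B L : ℤ) < |(p k).2.2| := hk₁.trans_le (hk k₁ (Finset.mem_univ _))
    have hkR' := lt_of_floor_lt_abs hkR
    set t := |((p k).2.2 : ℝ)| with ht
    have ht1 : 1 ≤ t := by
      have : (1 : ℤ) ≤ |(p k).2.2| := by omega
      rw [ht]; exact_mod_cast this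
    have htk : ∀ l, |((p l).2.2 : ℝ)| ≤ t := fun l => by
      rw [ht]; exact_mod_cast hk l (Finset.mem_univ l)
    have hwt := inv_pow_le_weight _ ht1 htk
    have hρt : ρ * β ≤ t := le_trans (le_of_eq (by rw [hρ]; ring)) hkR'.le
    have hu : ρ / t * β ≤ 1 := by
      rw [div_mul_eq_mul_div, div_le_one (by linarith)]; exact hρt
    have h5 : J ≤ A * F * ((K + 1) * (ρ / t)) ^ N := by
      have h6 : t ^ N * J ≤ A * F * ((K + 1) * ρ) ^ N := by
        refine (h₁ k).trans ?_
        gcongr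
        have e1 : (q : ℝ) / (B / L) ≤ K * ρ := by
          calc (q : ℝ) / (B / L) ≤ K * √B / (B / L) := by gcongr
            _ = K * ρ := by
              rw [hρ]
              nth_rewrite 2 [← hQQ]
              field_simp
        have e2 : |((p k).1 : ℝ) * (p k).2.1| / √B ≤ ρ := by
          rw [hρ]; exact div_le_div_of_nonneg_right (hp k) hQ0.le
        linarith
      rw [← mul_div_assoc, div_pow, ← mul_div_assoc, le_div_iff₀ (by positivity), mul_comm]
      exact h6
    refine h5.trans ?_
    rw [mul_pow, mul_assoc (A * F)]
    refine mul_le_mul_of_nonneg_left ?_ (by positivity)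
    have h7 : (ρ / t) ^ N ≤ (B ^ 3)⁻¹ * (2 ^ (2 * (n + 1)) * w) := by
      calc (ρ / t) ^ N = (ρ / t) ^ (1000 * (2 * (n + 1) + 3)) * (ρ / t) ^ (2 * (n + 1)) := by
            rw [hN, pow_add]
        _ ≤ (B ^ (2 * (n + 1) + 3))⁻¹ * (B / t) ^ (2 * (n + 1)) := by
            gcongr
            exact pow_le_rpow_neg hB (by positivity) hu _
        _ = (B ^ 3)⁻¹ * (t ^ (2 * (n + 1)))⁻¹ := by
            rw [div_pow, ← hBpow]; ring
        _ ≤ _ := by gcongr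
    calc (K + 1) ^ N * (ρ / t) ^ N ≤ (K + 2) ^ N * ((B ^ 3)⁻¹ * (2 ^ (2 * (n + 1)) * w)) := by
          gcongr
          linarith
      _ = _ := by ring

open Classical in
/-- The integral is of size `P ^ (n + 1) / (Q q)` on major triples and negligible otherwise. -/
lemma exists_norm_I_le {ε K : ℝ} (hε₀ : 0 < ε) (hε₁ : ε < 1) (hK : 0 < K) (i₀ j₀ : Fin (n + 1)) :
    ∃ A, 0 ≤ A ∧ ∀ (B : ℝ) (X Y q : ℕ) (x y c : Fin (n + 1) → ℤ), 1 ≤ B → 1 ≤ X → 1 ≤ Y →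
      ((X * Y : ℕ) : ℝ) ≤ B ^ (2 / 3 : ℝ) → 1 ≤ q → (q : ℝ) ≤ K * √B → x i₀ = X → y j₀ = Y →
      (∀ k, |x k| ≤ X) → (∀ k, |y k| ≤ Y) →
      ‖I ε B i₀ j₀ q x y c‖ ≤ A * |cQ √B| * ((B / (X * Y : ℕ)) ^ (n + 1) / (√B * q)) *
        ((if IsMajor B (X * Y) q (fun k => (x k, y k, c k)) then 1 else 0) +
          (B ^ 3)⁻¹ * weight c) := by
  obtain ⟨N, hN⟩ : ∃ N, N = 1000 * (2 * (n + 1) + 3) + 2 * (n + 1) := ⟨_, rfl⟩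
  -- With no integration by parts the estimate is the trivial bound, used on major triples; N
  -- integrations treat the rest.
  obtain ⟨A₀, hA₀, h₀⟩ := exists_bound_integral_amplitude (n := n) hε₀ hε₁ 0
  obtain ⟨A, hA, hA'⟩ := exists_bound_integral_amplitude (n := n) hε₀ hε₁ N
  refine ⟨A₀ + A * ((K + 2) ^ N * 2 ^ (2 * (n + 1))), by positivity, ?_⟩
  intro B X Y q x y c hB hX hY hL hq hqK hx hy hxk hyk
  have hB0 : 0 < B := by linarith
  have hQ0 : 0 < √B := Real.sqrt_pos.2 hB0
  have hX0 : (0 : ℝ) < X := by exact_mod_cast hX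
  have hY0 : (0 : ℝ) < Y := by exact_mod_cast hY
  have hq0 : (0 : ℝ) < q := by exact_mod_cast hq
  have hxi : (x i₀ : ℝ) = X := by rw [hx]; simp
  have hyj : (y j₀ : ℝ) = Y := by rw [hy]; simp
  rw [I_eq, norm_mul, Complex.norm_real, Real.norm_eq_abs, hxi, hyj, Nat.cast_mul]
  have hP : 0 < B / ((X : ℝ) * Y) := by positivity
  set m : Fin (n + 1) → ℝ := fun k => (x k : ℝ) * y k with hm
  obtain ⟨b₀, -⟩ := h₀ _ (√B) q m (fun k => (c k : ℝ)) hP hQ0 hq0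
  obtain ⟨b₁, b₂⟩ := hA' _ (√B) q m (fun k => (c k : ℝ)) hP hQ0 hq0
  set J := ‖∫ z, (amplitude ε (B / ((X : ℝ) * Y)) (√B) q m z : ℂ) *
    e (-(∑ k, (c k : ℝ) * z k) / q)‖ with hJ
  set F := (B / ((X : ℝ) * Y)) ^ (n + 1) / (√B * q) with hF
  have hF0 : 0 ≤ F := by positivity
  have hw := weight_nonneg c
  have key : J ≤ (A₀ + A * ((K + 2) ^ N * 2 ^ (2 * (n + 1)))) * F *
      ((if IsMajor B (X * Y) q (fun k => (x k, y k, c k)) then 1 else 0) +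
          (B ^ 3)⁻¹ * weight c) := by
    split_ifs with hmaj
    · have := b₀ 0
      rw [pow_zero, pow_zero, one_mul, mul_one] at this
      refine this.trans ?_
      calc A₀ * F = A₀ * F * 1 := (mul_one _).symm
        _ ≤ _ := by
          gcongr
          · have : 0 ≤ A * ((K + 2) ^ N * 2 ^ (2 * (n + 1))) := by positivity
            linarith
          · have : 0 ≤ (B ^ 3)⁻¹ * weight c := by positivity
            linarith
    · have := norm_integral_le_of_not_isMajor hB hK hF0 hA (Nat.mul_pos hX hY) hL hq hqK
        (fun k => (x k, y k, c k)) (J := J) (N := N) ?_ hN ?_ ?_ hmaj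
      · refine this.trans ?_
        rw [zero_add]
        calc A * F * ((K + 2) ^ N * 2 ^ (2 * (n + 1))) * ((B ^ 3)⁻¹ * weight c)
            = (A * ((K + 2) ^ N * 2 ^ (2 * (n + 1)))) * F * ((B ^ 3)⁻¹ * weight c) := by ring
          _ ≤ _ := by
            gcongr
            linarith
      · intro k
        have h1 : |(x k : ℝ)| ≤ X := by exact_mod_cast hxk k
        have h2 : |(y k : ℝ)| ≤ Y := by exact_mod_cast hyk k
        simp only
        rw [abs_mul, Nat.cast_mul]
        gcongr
      · intro k
        simp only [Nat.cast_mul]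
        exact b₁ k
      · intro k l hkl
        simp only [Nat.cast_mul]
        exact b₂ k l hkl
  calc |cQ √B| * J ≤ |cQ √B| * _ := mul_le_mul_of_nonneg_left key (abs_nonneg _)
    _ = _ := by ring

/-! ### Counting the major configurations -/

open Classical in
/-- The major configurations with `c ≠ 0`. -/
noncomputable def majorSet (n : ℕ) (B : ℝ) (X Y q : ℕ) : Finset (Fin (n + 1) → ℤ × ℤ × ℤ) :=
  (Fintype.piFinset fun _ => box X Y (radius B (X * Y))).filter fun p =>
    (∃ k, (p k).2.2 ≠ 0) ∧ IsMajor B (X * Y) q p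

lemma rpow_mul_pow_le {B C s κ : ℝ} {L : ℝ} {m : ℕ} (hB : 1 ≤ B)
    (hs : s * m ≤ κ) (hC : 0 ≤ C) (hL : 0 ≤ L) :
    (C * (L * B ^ s)) ^ m ≤ C ^ m * L ^ m * B ^ κ := by
  have hB0 : 0 < B := by linarith
  rw [mul_pow, mul_pow, ← Real.rpow_natCast (B ^ s), ← Real.rpow_mul hB0.le, ← mul_assoc]
  gcongr

/-- The bound for moduli larger than `B ^ (1 / 4)`. -/
lemma congr_factor_le {B K Cτ : ℝ} {L q R D : ℕ} (hB : 1 ≤ B) (hK : 0 < K) (hCτ : 0 ≤ Cτ)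
    (hL : (L : ℝ) ≤ B ^ (2 / 3 : ℝ)) (hq : 1 ≤ q) (hqK : (q : ℝ) ≤ K * √B)
    (hqB : B ^ (1 / 4 : ℝ) < q) (hD : (D : ℝ) ≤ Cτ * B ^ (1 / 1000 : ℝ)) (hR1 : 1 ≤ R)
    (hR : (R : ℝ) ≤ B ^ (1 / 1000 : ℝ) * (L / √B)) :
    ((2 * D * ((2 * L / q + 2) * (2 * R + 1)) : ℕ) : ℝ) ≤
      (12 * Cτ * (1 + K)) * (L * B ^ (3 / 1000 - 1 / 12 : ℝ)) := by
  have hB0 : 0 < B := by linarith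
  have hQ0 : 0 < √B := Real.sqrt_pos.2 hB0
  have hq0 : (0 : ℝ) < q := by exact_mod_cast hq
  have hR1' : (1 : ℝ) ≤ R := by exact_mod_cast hR1
  set β : ℝ := B ^ (1 / 1000 : ℝ) with hβ
  have hβ1 : 1 ≤ β := Real.one_le_rpow hB (by norm_num)
  have hρ6 : (L : ℝ) / √B ≤ B ^ (1 / 6 : ℝ) := rpow_sixth_facts hB hL
  have hL0 : (0 : ℝ) ≤ L := L.cast_nonneg
  -- A radius of at least 1 forces √B ≤ βL, hence q ≤ KβL: the term +2 in the count is absorbed into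
  -- a multiple of β L/q.
  have h1 : (q : ℝ) ≤ K * β * L := by
    have : √B ≤ β * L := by
      have h := hR1'.trans hR
      rw [← mul_div_assoc, one_le_div hQ0] at h
      exact h
    calc (q : ℝ) ≤ K * √B := hqK
      _ ≤ K * (β * L) := by gcongr
      _ = _ := by ring
  have h2 : ((2 * L / q : ℕ) : ℝ) + 2 ≤ 2 * (1 + K) * β * (L / q) := by
    have h3 : ((2 * L / q : ℕ) : ℝ) ≤ 2 * (L / q) := by
      refine Nat.cast_div_le.trans (le_of_eq ?_)
      push_cast; ring
    have h4 : 2 ≤ 2 * (K * β * (L / q)) := by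
      have : 1 ≤ K * β * L / q := (one_le_div hq0).2 h1
      rw [← mul_div_assoc]; linarith
    have h5 : (L : ℝ) / q ≤ β * (L / q) := le_mul_of_one_le_left (by positivity) hβ1
    linarith
  have h6 : (2 * R + 1 : ℝ) ≤ 3 * (β * B ^ (1 / 6 : ℝ)) := by
    have : β * (L / √B) ≤ β * B ^ (1 / 6 : ℝ) := by gcongr
    linarith
  have h7 : (L : ℝ) / q ≤ L * B ^ (-(1 / 4) : ℝ) := by
    rw [Real.rpow_neg hB0.le, ← div_eq_mul_inv]
    gcongr
  push_cast
  calc 2 * (D : ℝ) * ((((2 * L / q : ℕ) : ℝ) + 2) * (2 * R + 1))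
      ≤ 2 * (Cτ * β) * ((2 * (1 + K) * β * (L * B ^ (-(1 / 4) : ℝ))) *
        (3 * (β * B ^ (1 / 6 : ℝ)))) := by
        gcongr
        refine h2.trans ?_
        gcongr
    _ = (12 * Cτ * (1 + K)) * (L * (β * β * β * B ^ (-(1 / 4) : ℝ) * B ^ (1 / 6 : ℝ))) := by ring
    _ = _ := by
        rw [hβ, ← Real.rpow_add hB0, ← Real.rpow_add hB0, ← Real.rpow_add hB0, ← Real.rpow_add hB0]
        norm_num

/-- The bound for moduli up to `B ^ (1 / 4)`. -/
lemma near_factor_le {B Cτ : ℝ} {L q D : ℕ} (hB : 1 ≤ B) (hCτ : 0 ≤ Cτ)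
    (hL : (L : ℝ) ≤ B ^ (2 / 3 : ℝ)) (hqB : (q : ℝ) ≤ B ^ (1 / 4 : ℝ))
    (hD : (D : ℝ) ≤ Cτ * B ^ (1 / 1000 : ℝ)) :
    ((2 * D * (6 * minorBound B L q + 3 * radius B L) : ℕ) : ℝ) ≤
      (18 * Cτ) * (L * B ^ (2 / 1000 - 1 / 12 : ℝ)) := by
  have hB0 : 0 < B := by linarith
  have hL0 : (0 : ℝ) ≤ L := L.cast_nonneg
  have h1 : (minorBound B L q : ℝ) ≤ L * B ^ (1 / 1000 - 1 / 12 : ℝ) := by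
    calc (minorBound B L q : ℝ) ≤ q * (L : ℝ) ^ 2 * B ^ (1 / 1000 : ℝ) / B :=
          Nat.floor_le (by positivity)
      _ = L * (q * L * B ^ (1 / 1000 : ℝ) * B ^ (-1 : ℝ)) := by
          rw [Real.rpow_neg_one]; field_simp
      _ ≤ L * (B ^ (1 / 4 : ℝ) * B ^ (2 / 3 : ℝ) * B ^ (1 / 1000 : ℝ) * B ^ (-1 : ℝ)) := by gcongr
      _ = _ := by
          rw [← Real.rpow_add hB0, ← Real.rpow_add hB0, ← Real.rpow_add hB0]
          norm_num
  have h2 : (radius B L : ℝ) ≤ L * B ^ (1 / 1000 - 1 / 12 : ℝ) := by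
    calc (radius B L : ℝ) ≤ B ^ (1 / 1000 : ℝ) * L / √B := Nat.floor_le (by positivity)
      _ = L * B ^ (1 / 1000 - 1 / 2 : ℝ) := by
          rw [Real.sqrt_eq_rpow, Real.rpow_sub hB0]; ring
      _ ≤ _ := mul_le_mul_of_nonneg_left
          (Real.rpow_le_rpow_of_exponent_le hB (by norm_num)) hL0
  push_cast
  calc 2 * (D : ℝ) * (6 * minorBound B L q + 3 * radius B L)
      ≤ 2 * (Cτ * B ^ (1 / 1000 : ℝ)) * (6 * (L * B ^ (1 / 1000 - 1 / 12 : ℝ)) +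
        3 * (L * B ^ (1 / 1000 - 1 / 12 : ℝ))) := by gcongr
    _ = (18 * Cτ) * (L * (B ^ (1 / 1000 : ℝ) * B ^ (1 / 1000 - 1 / 12 : ℝ))) := by ring
    _ = _ := by
        rw [← Real.rpow_add hB0]
        norm_num

lemma exists_sum_majorSet_le (hn : 35 ≤ n) {K : ℝ} (hK : 0 < K) :
    ∃ C, 0 ≤ C ∧ ∀ (B : ℝ) (X Y q : ℕ), 1 ≤ B → 1 ≤ X → 1 ≤ Y →
      ((X * Y : ℕ) : ℝ) ≤ B ^ (2 / 3 : ℝ) → 1 ≤ q → (q : ℝ) ≤ K * √B →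
      ∑ p ∈ majorSet n B X Y q, (unitCount q p : ℝ) ≤
        C * q * ((X * Y : ℕ) : ℝ) ^ (n + 1) * B ^ (-(7 / 3) : ℝ) := by
  classical
  obtain ⟨Cτ, hCτ1, hCτ⟩ := exists_card_divisors_le (δ := 1 / 1000) (by norm_num)
  have hCτ0 : 0 ≤ Cτ := by linarith
  have hn' : (35 : ℝ) ≤ n := by exact_mod_cast hn
  refine ⟨(12 * Cτ * (1 + K)) ^ (n + 1) + (n + 1) * 27 * (18 * Cτ) ^ n, by positivity, ?_⟩
  intro B X Y q hB hX hY hL hq hqK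
  have hB0 : 0 < B := by linarith
  set L := X * Y with hLdef
  have hL0 : (0 : ℝ) ≤ L := L.cast_nonneg
  set D := ⌊Cτ * (L : ℝ) ^ (1 / 1000 : ℝ)⌋₊ with hD
  have hDB : DivisorBound L D := fun m hm hmL => Nat.le_floor ((hCτ m hm).trans (by gcongr))
  have hD' : (D : ℝ) ≤ Cτ * B ^ (1 / 1000 : ℝ) := by
    refine (Nat.floor_le (by positivity)).trans ?_
    gcongr
    refine hL.trans ?_
    conv_rhs => rw [← Real.rpow_one B]
    exact Real.rpow_le_rpow_of_exponent_le hB (by norm_num)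
  have hR : (radius B L : ℝ) ≤ B ^ (1 / 1000 : ℝ) * (L / √B) := by
    rw [← mul_div_assoc]; exact Nat.floor_le (by positivity)
  -- If the radius is 0, a major triple has c = 0, which is excluded, so there is nothing to count.
  rcases Nat.eq_zero_or_pos (radius B L) with hR0 | hR1
  · have : majorSet n B X Y q = ∅ := by
      refine Finset.filter_eq_empty_iff.2 fun p _ hp => ?_
      obtain ⟨⟨k, hk⟩, hmaj, -⟩ := hp
      have := hmaj k
      rw [hR0] at this
      exact hk (abs_eq_zero.1 (le_antisymm (by simpa using this) (abs_nonneg _)))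
    rw [this, Finset.sum_empty]
    positivity
  -- The two methods balance at q = B^{1/4}: the congruences save q B^{-1/6} per coordinate and the
  -- minors save B/(qL) ≥ B^{1/3}/q, up to factors B^{1/1000}.
  rcases lt_or_ge (B ^ (1 / 4 : ℝ)) (q : ℝ) with hqB | hqB
  · have h1 : ∑ p ∈ majorSet n B X Y q, unitCount q p ≤
        q * (2 * D * ((2 * L / q + 2) * (2 * radius B L + 1))) ^ (n + 1) :=
      (Finset.sum_le_sum_of_subset (Finset.filter_subset _ _)).trans
        (sum_unitCount_le hq hDB)
    have h2 := congr_factor_le hB hK hCτ0 hL hq hqK hqB hD' hR1 hR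
    calc ∑ p ∈ majorSet n B X Y q, (unitCount q p : ℝ)
        ≤ q * ((2 * D * ((2 * L / q + 2) * (2 * radius B L + 1)) : ℕ) : ℝ) ^ (n + 1) := by
          exact_mod_cast h1
      _ ≤ q * ((12 * Cτ * (1 + K)) * (L * B ^ (3 / 1000 - 1 / 12 : ℝ))) ^ (n + 1) := by gcongr
      _ ≤ q * ((12 * Cτ * (1 + K)) ^ (n + 1) * (L : ℝ) ^ (n + 1) * B ^ (-(7 / 3) : ℝ)) := by
          gcongr
          -- The exponent requirement is (n+1)(1/12 - 3/1000) ≥ 7/3.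
          refine rpow_mul_pow_le hB ?_ (by positivity) hL0
          push_cast
          linarith
      _ = (12 * Cτ * (1 + K)) ^ (n + 1) * (q * (L : ℝ) ^ (n + 1) * B ^ (-(7 / 3) : ℝ)) := by ring
      _ ≤ ((12 * Cτ * (1 + K)) ^ (n + 1) + (n + 1) * 27 * (18 * Cτ) ^ n) *
          (q * (L : ℝ) ^ (n + 1) * B ^ (-(7 / 3) : ℝ)) :=
          mul_le_mul_of_nonneg_right (le_add_of_nonneg_right (by positivity)) (by positivity)
      _ = _ := by ring
  · set Ncard := (majorSet n B X Y q).card with hNcard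
    have h1 : Ncard ≤ (n + 1) * ((box X Y (radius B L)).card *
        (2 * D * (6 * minorBound B L q + 3 * radius B L)) ^ n) := by
      refine le_trans (Finset.card_le_card fun p hp => ?_) (card_near_le hDB)
      rw [majorSet, Finset.mem_filter] at hp
      rw [Finset.mem_filter]
      exact ⟨hp.1, hp.2.1, hp.2.2.2 hqB⟩
    have h2 := near_factor_le hB hCτ0 hL hqB hD'
    have h3 : ((box X Y (radius B L)).card : ℝ) ≤ 27 * L * B ^ (1 / 1000 + 1 / 6 : ℝ) := by
      have hX' : (1 : ℝ) ≤ X := by exact_mod_cast hX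
      have hY' : (1 : ℝ) ≤ Y := by exact_mod_cast hY
      have hR1' : (1 : ℝ) ≤ radius B L := by exact_mod_cast hR1
      have hR2 : (radius B L : ℝ) ≤ B ^ (1 / 1000 + 1 / 6 : ℝ) := by
        rw [Real.rpow_add hB0]
        refine hR.trans ?_
        gcongr
        exact rpow_sixth_facts hB hL
      calc ((box X Y (radius B L)).card : ℝ)
          ≤ (2 * X + 1) * ((2 * Y + 1) * (2 * radius B L + 1)) := by
            exact_mod_cast card_box_le X Y (radius B L)
        _ ≤ (3 * X) * ((3 * Y) * (3 * B ^ (1 / 1000 + 1 / 6 : ℝ))) := by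
            gcongr <;> linarith
        _ = _ := by rw [hLdef]; push_cast; ring
    calc ∑ p ∈ majorSet n B X Y q, (unitCount q p : ℝ)
        ≤ ∑ p ∈ majorSet n B X Y q, (q : ℝ) :=
          Finset.sum_le_sum fun p _ => by exact_mod_cast unitCount_le q p
      _ = q * Ncard := by rw [Finset.sum_const, nsmul_eq_mul, mul_comm]
      _ ≤ q * ((n + 1) * ((box X Y (radius B L)).card *
        ((2 * D * (6 * minorBound B L q + 3 * radius B L) : ℕ) : ℝ) ^ n)) := by
          gcongr
          exact_mod_cast h1
      _ ≤ q * ((n + 1) * ((27 * L * B ^ (1 / 1000 + 1 / 6 : ℝ)) *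
        ((18 * Cτ) ^ n * (L : ℝ) ^ n * B ^ (-(7 / 3) - (1 / 1000 + 1 / 6) : ℝ)))) := by
          gcongr
          refine (pow_le_pow_left₀ (Nat.cast_nonneg _) h2 n).trans ?_
          -- The n confined coordinates must also repay the free one: n(1/12 - 2/1000) ≥ 7/3 + 1/6 +
          -- 1/1000.
          refine rpow_mul_pow_le hB ?_ (by positivity) hL0
          linarith
      _ = ((n + 1) * 27 * (18 * Cτ) ^ n) * (q * (L : ℝ) ^ (n + 1) * B ^ (-(7 / 3) : ℝ)) := by
          rw [Real.rpow_sub hB0, pow_succ (L : ℝ)]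
          have : B ^ (1 / 1000 + 1 / 6 : ℝ) ≠ 0 := by positivity
          field_simp
      _ ≤ ((12 * Cτ * (1 + K)) ^ (n + 1) + (n + 1) * 27 * (18 * Cτ) ^ n) *
          (q * (L : ℝ) ^ (n + 1) * B ^ (-(7 / 3) : ℝ)) :=
          mul_le_mul_of_nonneg_right (le_add_of_nonneg_left (by positivity)) (by positivity)
      _ = _ := by ring

/-! ### Supports of the weights and summation over all variables -/

lemma wRest_support {ε : ℝ} (hε : 0 < ε) {i₀ : Fin (n + 1)} {x : Fin (n + 1) → ℤ}
    (hx : 1 < (x i₀ : ℝ)) (h : wRest ε i₀ x ≠ 0) (k : Fin (n + 1)) : x k ≠ 0 ∧ |x k| ≤ x i₀ := by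
  have hx' : 1 < x i₀ := by exact_mod_cast hx
  have hx0 : 0 < (x i₀ : ℝ) := by linarith
  by_cases hk : k = i₀
  · subst hk
    exact ⟨by omega, (abs_of_pos (by omega)).le⟩
  have h1 := Finset.prod_ne_zero_iff.1 h k (Finset.mem_erase.2 ⟨hk, Finset.mem_univ k⟩)
  have h2 := pos_of_step_ne_zero hε (left_ne_zero_of_mul h1)
  have h3 := pos_of_step_ne_zero hε (right_ne_zero_of_mul h1)
  rw [← sub_div] at h3
  have h4 := (div_pos_iff_of_pos_right hx0).1 h3
  rw [sub_pos, div_lt_one hx0] at h2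
  refine ⟨?_, ?_⟩
  · rintro h0
    rw [h0] at h4
    norm_num at h4
  · exact_mod_cast h2.le

/-- The range of summation for given maxima `X` and `Y`. -/
def Admissible (B : ℝ) (X Y : ℕ) (x y : Fin (n + 1) → ℤ) : Prop :=
  ((X * Y : ℕ) : ℝ) ≤ B ^ (2 / 3 : ℝ) ∧ ∀ k, (x k ≠ 0 ∧ |x k| ≤ X) ∧ (y k ≠ 0 ∧ |y k| ≤ Y)

lemma exists_admissible {ε B : ℝ} (hε : 0 < ε) {i₀ j₀ : Fin (n + 1)} {x y : Fin (n + 1) → ℤ}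
    (h : wMax ε B (x i₀) (y j₀) * (wRest ε i₀ x * wRest ε j₀ y) ≠ 0) :
    ∃ X Y : ℕ, 1 ≤ X ∧ 1 ≤ Y ∧ x i₀ = X ∧ y j₀ = Y ∧ Admissible B X Y x y := by
  have hM := left_ne_zero_of_mul h
  have hR := right_ne_zero_of_mul h
  have h4 := pos_of_step_ne_zero hε (right_ne_zero_of_mul hM)
  have h3 := pos_of_step_ne_zero hε (right_ne_zero_of_mul (left_ne_zero_of_mul hM))
  have h1 := pos_of_step_ne_zero hε
    (left_ne_zero_of_mul (left_ne_zero_of_mul (left_ne_zero_of_mul hM)))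
  rw [sub_pos] at h1 h3 h4
  have hx1 : 1 < x i₀ := by exact_mod_cast h1
  have hy1 : 1 < y j₀ := by exact_mod_cast h3
  have hX : ((x i₀).toNat : ℤ) = x i₀ := Int.toNat_of_nonneg (by omega)
  have hY : ((y j₀).toNat : ℤ) = y j₀ := Int.toNat_of_nonneg (by omega)
  have hX' : ((x i₀).toNat : ℝ) = x i₀ := by exact_mod_cast congrArg (Int.cast : ℤ → ℝ) hX
  have hY' : ((y j₀).toNat : ℝ) = y j₀ := by exact_mod_cast congrArg (Int.cast : ℤ → ℝ) hY
  refine ⟨(x i₀).toNat, (y j₀).toNat, by omega, by omega, hX.symm, hY.symm, ?_, fun k => ⟨?_, ?_⟩⟩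
  · rw [Nat.cast_mul, hX', hY']; exact h4.le
  · rw [hX]; exact wRest_support hε h1 (left_ne_zero_of_mul hR) k
  · rw [hY]; exact wRest_support hε h3 (right_ne_zero_of_mul hR) k

lemma abs_weights_le_one (ε B : ℝ) (i₀ j₀ : Fin (n + 1)) (x y : Fin (n + 1) → ℤ) :
    |wMax ε B (x i₀) (y j₀) * (wRest ε i₀ x * wRest ε j₀ y)| ≤ 1 := by
  have hs : ∀ t, |step ε t| ≤ 1 := fun t => by
    rw [abs_of_nonneg (step_nonneg ε t)]; exact step_le_one ε t
  have hr : ∀ (i : Fin (n + 1)) (x : Fin (n + 1) → ℤ), |wRest ε i x| ≤ 1 := fun i x => by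
    rw [wRest, Finset.abs_prod]
    refine Finset.prod_le_one (fun _ _ => abs_nonneg _) fun k _ => ?_
    rw [abs_mul]
    exact mul_le_one₀ (hs _) (abs_nonneg _) (hs _)
  rw [abs_mul, abs_mul, wMax, abs_mul, abs_mul, abs_mul]
  exact mul_le_one₀ (mul_le_one₀ (mul_le_one₀ (mul_le_one₀ (hs _) (abs_nonneg _) (hs _))
    (abs_nonneg _) (hs _)) (abs_nonneg _) (hs _)) (by positivity)
    (mul_le_one₀ (hr _ _) (abs_nonneg _) (hr _ _))

open Classical in
/-- The majorant of the contribution of a modulus `q`, up to a factor depending on `X, Y, q`. -/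
noncomputable def majorant (B : ℝ) (X Y q : ℕ) (x y c : Fin (n + 1) → ℤ) : ℝ :=
  if Admissible B X Y x y then (unitCount q fun k => (x k, y k, c k)) *
    ((if IsMajor B (X * Y) q (fun k => (x k, y k, c k)) then 1 else 0) + (B ^ 3)⁻¹ * weight c)
  else 0

lemma majorant_nonneg {B : ℝ} (hB : 0 ≤ B) (X Y q : ℕ) (x y c : Fin (n + 1) → ℤ) :
    0 ≤ majorant B X Y q x y c := by
  classical
  have := weight_nonneg c
  unfold majorant
  split_ifs <;> positivity

/-- The bound is uniform over finite sets of triples, so it will give summability as well as size.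
Major triples are covered by `exists_sum_majorSet_le`; for the others the unit count is at most q,
there are at most (9XY)^{n+1} pairs (x, y), the weight sums over c to a constant, and B^{-3} ≤
B^{-7/3}. -/
lemma exists_sum_majorant_le (hn : 35 ≤ n) {K : ℝ} (hK : 0 < K) :
    ∃ C, 0 ≤ C ∧ ∀ (B : ℝ) (X Y q : ℕ)
      (s : Finset ((Fin (n + 1) → ℤ) × (Fin (n + 1) → ℤ) × {c : Fin (n + 1) → ℤ // c ≠ 0})),
      1 ≤ B → 1 ≤ X → 1 ≤ Y → 1 ≤ q → (q : ℝ) ≤ K * √B →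
      ∑ t ∈ s, majorant B X Y q t.1 t.2.1 t.2.2.1 ≤
        C * q * ((X * Y : ℕ) : ℝ) ^ (n + 1) * B ^ (-(7 / 3) : ℝ) := by
  classical
  obtain ⟨C, hC0, hC⟩ := exists_sum_majorSet_le hn hK
  obtain ⟨W, hW0, hW⟩ := exists_sum_weight_le n
  refine ⟨C + 9 ^ (n + 1) * W, by positivity, ?_⟩
  intro B X Y q s hB hX hY hq hqK
  have hB0 : 0 < B := by linarith
  by_cases hL : ((X * Y : ℕ) : ℝ) ≤ B ^ (2 / 3 : ℝ)
  swap
  · have h0 : ∑ t ∈ s, majorant B X Y q t.1 t.2.1 t.2.2.1 = 0 :=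
      Finset.sum_eq_zero fun t _ => by rw [majorant, if_neg fun h => hL h.1]
    rw [h0]
    positivity
  set cfg : (Fin (n + 1) → ℤ) × (Fin (n + 1) → ℤ) × {c : Fin (n + 1) → ℤ // c ≠ 0} →
    Fin (n + 1) → ℤ × ℤ × ℤ := fun t k => (t.1 k, t.2.1 k, t.2.2.1 k) with hcfg
  have hinj : Function.Injective cfg := by
    rintro ⟨x, y, c, hc⟩ ⟨x', y', c', hc'⟩ h
    have h1 : x = x' := funext fun k => congrArg Prod.fst (congrFun h k)
    have h2 : y = y' := funext fun k => congrArg (fun v => v.2.1) (congrFun h k)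
    have h3 : c = c' := funext fun k => congrArg (fun v => v.2.2) (congrFun h k)
    subst h1 h2 h3
    rfl
  set s' := s.filter fun t => Admissible B X Y t.1 t.2.1 with hs'
  have hsplit : ∑ t ∈ s, majorant B X Y q t.1 t.2.1 t.2.2.1 =
      ∑ t ∈ s'.filter (fun t => IsMajor B (X * Y) q (cfg t)), (unitCount q (cfg t) : ℝ) +
      ∑ t ∈ s', (unitCount q (cfg t) : ℝ) * ((B ^ 3)⁻¹ * weight t.2.2.1) := by
    rw [Finset.sum_filter, ← Finset.sum_add_distrib, hs', Finset.sum_filter]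
    refine Finset.sum_congr rfl fun t _ => ?_
    simp only [majorant, mul_add, mul_ite, mul_one, mul_zero, hcfg]
  have hmaj : ∑ t ∈ s'.filter (fun t => IsMajor B (X * Y) q (cfg t)), (unitCount q (cfg t) : ℝ) ≤
      C * q * ((X * Y : ℕ) : ℝ) ^ (n + 1) * B ^ (-(7 / 3) : ℝ) := by
    refine le_trans ?_ (hC B X Y q hB hX hY hL hq hqK)
    rw [← Finset.sum_image (f := fun p => (unitCount q p : ℝ)) hinj.injOn]
    refine Finset.sum_le_sum_of_subset_of_nonneg (fun p hp => ?_) fun _ _ _ => by positivity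
    obtain ⟨t, ht, rfl⟩ := Finset.mem_image.1 hp
    rw [Finset.mem_filter, hs', Finset.mem_filter] at ht
    obtain ⟨⟨-, -, hadm⟩, hmaj⟩ := ht
    rw [majorSet, Finset.mem_filter, Fintype.mem_piFinset]
    refine ⟨fun k => mem_box.2 ⟨⟨(hadm k).1.2, (hadm k).2.2, hmaj.1 k⟩,
      mul_ne_zero (hadm k).1.1 (hadm k).2.1⟩, ?_, hmaj⟩
    exact Function.ne_iff.1 t.2.2.2
  have hweight : ∑ t ∈ s', weight t.2.2.1 ≤ (9 * ((X * Y : ℕ) : ℝ)) ^ (n + 1) * W := by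
    set S := (Fintype.piFinset fun _ : Fin (n + 1) => Finset.Icc (-X : ℤ) X) ×ˢ
      (Fintype.piFinset fun _ : Fin (n + 1) => Finset.Icc (-Y : ℤ) Y) ×ˢ
      (s.image fun t => t.2.2) with hS
    calc ∑ t ∈ s', weight t.2.2.1 ≤ ∑ t ∈ S, weight t.2.2.1 := by
          refine Finset.sum_le_sum_of_subset_of_nonneg (fun t ht => ?_) fun _ _ _ => weight_nonneg _
          rw [hs', Finset.mem_filter] at ht
          rw [hS, Finset.mem_product, Finset.mem_product, Fintype.mem_piFinset,
            Fintype.mem_piFinset]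
          exact ⟨fun k => Finset.mem_Icc.2 (abs_le.1 (ht.2.2 k).1.2),
            fun k => Finset.mem_Icc.2 (abs_le.1 (ht.2.2 k).2.2), Finset.mem_image_of_mem _ ht.1⟩
      _ = (((2 * X + 1) * (2 * Y + 1) : ℕ) : ℝ) ^ (n + 1) *
          ∑ c ∈ s.image fun t => t.2.2, weight c.1 := by
          rw [hS]
          simp only [Finset.sum_product, Finset.sum_const, Fintype.card_piFinset,
            Finset.prod_const, Finset.card_univ, Fintype.card_fin, Int.card_Icc, nsmul_eq_mul]
          have e1 : ∀ Z : ℕ, ((Z : ℤ) + 1 - -Z).toNat = 2 * Z + 1 := fun Z => by omega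
          rw [e1, e1]
          push_cast
          rw [mul_pow]
          ring
      _ ≤ _ := by
          have hX' : (1 : ℝ) ≤ X := by exact_mod_cast hX
          have hY' : (1 : ℝ) ≤ Y := by exact_mod_cast hY
          gcongr
          · exact Finset.sum_nonneg fun _ _ => weight_nonneg _
          · push_cast
            nlinarith
          · have := hW ((s.image fun t => t.2.2).map (Function.Embedding.subtype _))
            rw [Finset.sum_map] at this
            exact this
  have hrest : ∑ t ∈ s', (unitCount q (cfg t) : ℝ) * ((B ^ 3)⁻¹ * weight t.2.2.1) ≤
      (9 ^ (n + 1) * W) * q * ((X * Y : ℕ) : ℝ) ^ (n + 1) * B ^ (-(7 / 3) : ℝ) := by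
    have hB3 : (B ^ 3)⁻¹ ≤ B ^ (-(7 / 3) : ℝ) := by
      rw [← Real.rpow_natCast, ← Real.rpow_neg hB0.le]
      exact Real.rpow_le_rpow_of_exponent_le hB (by norm_num)
    calc _ ≤ ∑ t ∈ s', (q : ℝ) * (B ^ (-(7 / 3) : ℝ) * weight t.2.2.1) := by
          refine Finset.sum_le_sum fun t _ => ?_
          have := weight_nonneg t.2.2.1
          have h2 : (unitCount q (cfg t) : ℝ) ≤ q := by exact_mod_cast unitCount_le q _
          gcongr
      _ = q * (B ^ (-(7 / 3) : ℝ) * ∑ t ∈ s', weight t.2.2.1) := by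
          rw [Finset.mul_sum, Finset.mul_sum]
      _ ≤ q * (B ^ (-(7 / 3) : ℝ) * ((9 * ((X * Y : ℕ) : ℝ)) ^ (n + 1) * W)) := by gcongr
      _ = _ := by rw [mul_pow]; ring
  rw [hsplit]
  refine (add_le_add hmaj hrest).trans (le_of_eq ?_)
  ring

/-- The shape of the size of one modulus. -/
noncomputable def scale (n : ℕ) (B : ℝ) (X Y q : ℕ) : ℝ := (B / (X * Y : ℕ)) ^ (n + 1) / (√B * q)

lemma exists_norm_term_le {ε K : ℝ} (hε₀ : 0 < ε) (hε₁ : ε < 1) (hK : 0 < K) (i₀ j₀ : Fin (n + 1)) :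
    ∃ A, 0 ≤ A ∧ ∀ (B : ℝ) (x y c : Fin (n + 1) → ℤ), 1 ≤ B →
      ‖term ε K B i₀ j₀ x y c‖ ≤ ∑ X ∈ Finset.Icc 1 ⌊B ^ (2 / 3 : ℝ)⌋₊,
        ∑ Y ∈ Finset.Icc 1 ⌊B ^ (2 / 3 : ℝ)⌋₊, ∑ q ∈ Finset.Icc 1 ⌊K * √B⌋₊,
          A * |cQ √B| * scale n B X Y q * majorant B X Y q x y c := by
  classical
  obtain ⟨A, hA0, hA⟩ := exists_norm_I_le (n := n) hε₀ hε₁ hK i₀ j₀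
  refine ⟨A, hA0, fun B x y c hB => ?_⟩
  have hB0 : 0 ≤ B := by linarith
  have hnn : ∀ X Y q : ℕ, 0 ≤ A * |cQ √B| * scale n B X Y q * majorant B X Y q x y c := by
    intro X Y q
    have := majorant_nonneg hB0 X Y q x y c
    unfold scale
    positivity
  by_cases hw : wMax ε B (x i₀) (y j₀) * (wRest ε i₀ x * wRest ε j₀ y) = 0
  · rw [term, hw, Complex.ofReal_zero, zero_mul, norm_zero]
    exact Finset.sum_nonneg fun X _ => Finset.sum_nonneg fun Y _ => Finset.sum_nonneg fun q _ =>
      hnn X Y q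
  obtain ⟨X, Y, hX, hY, hxX, hyY, hadm⟩ := exists_admissible hε₀ hw
  have hXb : X ∈ Finset.Icc 1 ⌊B ^ (2 / 3 : ℝ)⌋₊ :=
    Finset.mem_Icc.2 ⟨hX, (Nat.le_mul_of_pos_right X hY).trans (Nat.le_floor hadm.1)⟩
  have hYb : Y ∈ Finset.Icc 1 ⌊B ^ (2 / 3 : ℝ)⌋₊ :=
    Finset.mem_Icc.2 ⟨hY, (Nat.le_mul_of_pos_left Y hX).trans (Nat.le_floor hadm.1)⟩
  -- The single pair (X, Y) attached to (x, y) is replaced by the sum over all pairs, whose terms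
  -- are nonnegative; X and Y thus become independent of the triple and the summations can be
  -- exchanged.
  refine le_trans ?_ (Finset.single_le_sum (f := fun X => ∑ Y ∈ Finset.Icc 1 ⌊B ^ (2 / 3 : ℝ)⌋₊,
    ∑ q ∈ Finset.Icc 1 ⌊K * √B⌋₊, A * |cQ √B| * scale n B X Y q * majorant B X Y q x y c)
    (fun X _ => Finset.sum_nonneg fun Y _ => Finset.sum_nonneg fun q _ => hnn X Y q) hXb)
  refine le_trans ?_ (Finset.single_le_sum (f := fun Y => ∑ q ∈ Finset.Icc 1 ⌊K * √B⌋₊,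
    A * |cQ √B| * scale n B X Y q * majorant B X Y q x y c)
    (fun Y _ => Finset.sum_nonneg fun q _ => hnn X Y q) hYb)
  rw [term, norm_mul, Complex.norm_real, Real.norm_eq_abs]
  refine (mul_le_of_le_one_left (norm_nonneg _) (abs_weights_le_one ε B i₀ j₀ x y)).trans ?_
  refine (norm_sum_le _ _).trans (Finset.sum_le_sum fun q hq => ?_)
  rw [Finset.mem_Icc] at hq
  have hqK : (q : ℝ) ≤ K * √B := (Nat.le_floor_iff (by positivity)).1 hq.2
  have h1 := norm_S_le (n := n) (by omega : q ≠ 0) x y c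
  have h2 := hA B X Y q x y c hB hX hY hadm.1 hq.1 hqK hxX hyY (fun k => (hadm.2 k).1.2)
    (fun k => (hadm.2 k).2.2)
  rw [norm_mul, majorant, if_pos hadm]
  calc _ ≤ _ := mul_le_mul h1 h2 (norm_nonneg _) (Nat.cast_nonneg _)
    _ = _ := by rw [scale]; ring

/-- The factors q and (XY)^{n+1} cancel against `scale`, so every (X, Y, q) contributes the same
O(B^{n+1-7/3-1/2}). There are at most B^{4/3} · K B^{1/2} such triples, which yields B^n. -/
lemma exists_sum_norm_term_le (hn : 35 ≤ n) {ε K : ℝ} (hε₀ : 0 < ε) (hε₁ : ε < 1) (hK : 0 < K)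
    (i₀ j₀ : Fin (n + 1)) :
    ∃ A, 0 ≤ A ∧ ∀ (B : ℝ)
      (s : Finset ((Fin (n + 1) → ℤ) × (Fin (n + 1) → ℤ) × {c : Fin (n + 1) → ℤ // c ≠ 0})),
      1 ≤ B → ∑ t ∈ s, ‖term ε K B i₀ j₀ t.1 t.2.1 t.2.2.1‖ ≤ A * |cQ √B| * B ^ n := by
  obtain ⟨A, hA0, hA⟩ := exists_norm_term_le (n := n) hε₀ hε₁ hK i₀ j₀
  obtain ⟨C, hC0, hC⟩ := exists_sum_majorant_le hn hK
  refine ⟨A * C * K, by positivity, fun B s hB => ?_⟩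
  have hB0 : 0 < B := by linarith
  have hQ0 : 0 < √B := Real.sqrt_pos.2 hB0
  set b := ⌊B ^ (2 / 3 : ℝ)⌋₊ with hb
  have hbB : (b : ℝ) ≤ B ^ (2 / 3 : ℝ) := Nat.floor_le (by positivity)
  set k := ⌊K * √B⌋₊ with hk
  have hkB : (k : ℝ) ≤ K * √B := Nat.floor_le (by positivity)
  calc ∑ t ∈ s, ‖term ε K B i₀ j₀ t.1 t.2.1 t.2.2.1‖
      ≤ ∑ t ∈ s, ∑ X ∈ Finset.Icc 1 b, ∑ Y ∈ Finset.Icc 1 b, ∑ q ∈ Finset.Icc 1 k,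
          A * |cQ √B| * scale n B X Y q * majorant B X Y q t.1 t.2.1 t.2.2.1 :=
        Finset.sum_le_sum fun t _ => hA B _ _ _ hB
    _ = ∑ X ∈ Finset.Icc 1 b, ∑ Y ∈ Finset.Icc 1 b, ∑ q ∈ Finset.Icc 1 k,
          A * |cQ √B| * scale n B X Y q * ∑ t ∈ s, majorant B X Y q t.1 t.2.1 t.2.2.1 := by
        rw [Finset.sum_comm]
        refine Finset.sum_congr rfl fun X _ => ?_
        rw [Finset.sum_comm]
        refine Finset.sum_congr rfl fun Y _ => ?_
        rw [Finset.sum_comm]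
        exact Finset.sum_congr rfl fun q _ => (Finset.mul_sum _ _ _).symm
    _ ≤ ∑ X ∈ Finset.Icc 1 b, ∑ Y ∈ Finset.Icc 1 b, ∑ q ∈ Finset.Icc 1 k,
          A * |cQ √B| * C * (B ^ (n + 1) * B ^ (-(7 / 3) : ℝ) / √B) := by
        refine Finset.sum_le_sum fun X hX => Finset.sum_le_sum fun Y hY =>
          Finset.sum_le_sum fun q hq => ?_
        rw [Finset.mem_Icc] at hX hY hq
        have hqK : (q : ℝ) ≤ K * √B := (Nat.le_floor_iff (by positivity)).1 hq.2
        have hX0 : (0 : ℝ) < X := by exact_mod_cast hX.1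
        have hY0 : (0 : ℝ) < Y := by exact_mod_cast hY.1
        have hq0 : (0 : ℝ) < q := by exact_mod_cast hq.1
        have hs0 : 0 ≤ scale n B X Y q := by unfold scale; positivity
        calc _ ≤ A * |cQ √B| * scale n B X Y q *
              (C * q * ((X * Y : ℕ) : ℝ) ^ (n + 1) * B ^ (-(7 / 3) : ℝ)) := by
              gcongr
              exact hC B X Y q s hB hX.1 hY.1 hq.1 hqK
          _ = _ := by
              unfold scale
              push_cast
              rw [div_pow]
              field_simp
    _ = (b * (b * (k * (A * |cQ √B| * C * (B ^ (n + 1) * B ^ (-(7 / 3) : ℝ) / √B))))) := by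
        simp [Finset.sum_const]
    _ ≤ (B ^ (2 / 3 : ℝ) * (B ^ (2 / 3 : ℝ) * ((K * √B) *
          (A * |cQ √B| * C * (B ^ (n + 1) * B ^ (-(7 / 3) : ℝ) / √B))))) := by gcongr
    _ = (A * C * K) * |cQ √B| * B ^ n *
          (B * B ^ (2 / 3 : ℝ) * B ^ (2 / 3 : ℝ) * B ^ (-(7 / 3) : ℝ)) := by
        rw [pow_succ]
        field_simp
    _ = _ := by
        have : B * B ^ (2 / 3 : ℝ) * B ^ (2 / 3 : ℝ) * B ^ (-(7 / 3) : ℝ) = 1 := by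
          nth_rewrite 1 [← Real.rpow_one B]
          rw [← Real.rpow_add hB0, ← Real.rpow_add hB0, ← Real.rpow_add hB0]
          norm_num
        rw [this, mul_one]

end TriProjective

theorem mainTheorem2 (n : ℕ) (hn : 35 ≤ n) (i₀ j₀ : Fin (n + 1)) (ε : ℝ) (hε₀ : 0 < ε)
    (hε₁ : ε < 1) (K : ℝ) (hK : 0 < K) :
    (∀ B : ℝ, 1 ≤ B → Summable
      (fun p : (Fin (n + 1) → ℤ) × (Fin (n + 1) → ℤ) × {c : Fin (n + 1) → ℤ // c ≠ 0} =>
        TriProjective.term ε K B i₀ j₀ p.1 p.2.1 p.2.2.1)) ∧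
    (fun B : ℝ =>
      ∑' p : (Fin (n + 1) → ℤ) × (Fin (n + 1) → ℤ) × {c : Fin (n + 1) → ℤ // c ≠ 0},
        TriProjective.term ε K B i₀ j₀ p.1 p.2.1 p.2.2.1) =O[atTop] (fun B : ℝ => B ^ n) := by
  obtain ⟨A, hA0, hA⟩ := TriProjective.exists_sum_norm_term_le hn hε₀ hε₁ hK i₀ j₀
  obtain ⟨C, hC⟩ := TriProjective.exists_abs_cQ_le
  -- For fixed B the value of c_Q is just a number, so summability holds for every B ≥ 1; its
  -- uniform bound is needed only for the asymptotic estimate.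
  have hsum : ∀ B : ℝ, 1 ≤ B → Summable
      (fun p : (Fin (n + 1) → ℤ) × (Fin (n + 1) → ℤ) × {c : Fin (n + 1) → ℤ // c ≠ 0} =>
        ‖TriProjective.term ε K B i₀ j₀ p.1 p.2.1 p.2.2.1‖) := fun B hB =>
    summable_of_sum_le (fun _ => norm_nonneg _) fun s => hA B s hB
  refine ⟨fun B hB => (hsum B hB).of_norm, IsBigO.of_bound (A * C) ?_⟩
  -- The threshold 64 makes √B ≥ 8, where c_Q is bounded.
  filter_upwards [eventually_ge_atTop (64 : ℝ)] with B hB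
  have hB1 : 1 ≤ B := by linarith
  have hQ : 8 ≤ √B := Real.le_sqrt_of_sq_le (by linarith)
  rw [Real.norm_of_nonneg (by positivity)]
  calc _ ≤ _ := norm_tsum_le_tsum_norm (hsum B hB1)
    _ ≤ A * |TriProjective.cQ √B| * B ^ n :=
      Real.tsum_le_of_sum_le (fun _ => norm_nonneg _) fun s => hA B s hB1
    _ ≤ A * C * B ^ n := by
      gcongr
      exact hC _ hQ
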